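/- Throughout, a groupoid means an étale, locally compact topological groupoid with Hausdorff object space (the arrow space may be non-Hausdorff), with range and source maps \(r,s\); products \(gh\) are defined when \(s(g)=r(h)\). A bisection of a groupoid \(H\) is an open set of arrows on which \(r\) and \(s\) are injective. Let \(\Gamma=(r,s\colon E\rightrightarrows V)\) be a directed graph, and let \(V_{\mathrm{reg}}\) be its set of regular vertices, that is, of those \(v\in V\) for which \(r^{-1}(v)\) is finite and nonempty. View \(V\) as a discrete groupoid with only identity arrows and the discrete set \(E\) as a groupoid correspondence \(E\colon V\leftarrow V\). An action of \((V,E,V_{\mathrm{reg}})\) on a topological space \(Y\) then consists of a continuous map \(\varrho\colon Y\to V\) and a continuous open map \(E\times_{s,V,\varrho}Y\to Y\), \((e,y)\mapsto e\cdot y\), such that \(\varrho(e\cdot y)=r(e)\); \(e\cdot y=e'\cdot y'\) only if \(e=e'\) and \(y=y'\); \(\varrho^{-1}(V_{\mathrm{reg}})\subseteq E\cdot Y\); and, for each finite set \(K\subseteq E\), the set of all \(e\cdot y\) with \(e\in K\), \(s(e)=\varrho(y)\) is closed in \(Y\). A map \(\varphi\colon Y_1\to Y_2\) between two spaces with such actions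 is equivariant if \(\varrho_2\circ\varphi=\varrho_1\), \(\varphi(e\cdot y)=e\cdot\varphi(y)\) whenever \(s(e)=\varrho_1(y)\), and \(\varphi^{-1}(E\cdot Y_2)=E\cdot Y_1\). A groupoid model of \((V,E,V_{\mathrm{reg}})\) is a groupoid \(M\) together with, for every topological space \(Y\), a bijection between \(M\)-actions on \(Y\) and \((V,E,V_{\mathrm{reg}})\)-actions on \(Y\), such that a continuous map between two spaces is equivariant for \((V,E,V_{\mathrm{reg}})\)-actions if and only if it is equivariant for the associated \(M\)-actions. An actor \(M\to H\) between groupoids is an action of \(M\) on the arrow space of \(H\) that commutes with the right translation action of \(H\); it is proper if the map \(H^0\cong H/H\to M^0\) induced by its anchor map is proper. A dynamical Cuntz–Krieger \(\Gamma\)-family in \(H\) consists of compact open subsets \(\Omega_v\subseteq H^0\) for \(v\in V\) and bisections \(T_e\subseteq H\) for \(e\in E\) such that (1) \(\Omega_v\cap\Omega_w=\emptyset\) for \(v\neq w\); (2) \(s(T_e)=\Omega_{s(e)}\) and \(r(T_e)\subseteq\Omega_{r(e)}\) for all \(e\in E\); (3) \(r(T_e)\cap r(T_f)=\emptyset\)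 for \(e\neq f\); (4) \(\bigsqcup_{r(e)=v}r(T_e)=\Omega_v\) for each \(v\in V_{\mathrm{reg}}\). It is nondegenerate if \(H^0=\bigsqcup_{v\in V}\Omega_v\). **Statement.** Let \(M\) be a groupoid model of \((V,E,V_{\mathrm{reg}})\) and let \(H\) be any groupoid. Then there is a canonical bijection between proper actors \(M\to H\) and nondegenerate dynamical Cuntz–Krieger \(\Gamma\)-families in \(H\). Explicitly, if \(\varrho\) and \((e,h)\mapsto e\cdot h\) denote the \((V,E,V_{\mathrm{reg}})\)-action on the arrow space of \(H\) that corresponds to the actor, then the associated family is \[ \Omega_v=\{\omega\in H^0 : \varrho(1_\omega)=v\},\qquad T_e=\{e\cdot 1_\omega : \omega\in H^0,\ \varrho(1_\omega)=s(e)\}. \] -/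

import Mathlib

open Topology

universe u

/-- An étale, locally compact topological groupoid with Hausdorff object space.  Products
`mul g h` are defined when `s g = r h`.  The arrow space may be non-Hausdorff; it is locally
compact because `s` is a local homeomorphism to a locally compact space. -/
structure EtaleGroupoid : Type (u + 1) where
  Obj : Type u
  Arr : Type u
  [topObj : TopologicalSpace Obj]
  [topArr : TopologicalSpace Arr]
  r : Arr → Obj
  s : Arr → Obj
  one : Obj → Arr
  inv : Arr → Arr
  mul : (g h : Arr) → s g = r h → Arr
  r_one : ∀ ω, r (one ω) = ω
  s_one : ∀ ω, s (one ω) = ω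
  r_inv : ∀ g, r (inv g) = s g
  s_inv : ∀ g, s (inv g) = r g
  r_mul : ∀ g h (c : s g = r h), r (mul g h c) = r g
  s_mul : ∀ g h (c : s g = r h), s (mul g h c) = s h
  mul_assoc : ∀ g h k (c : s g = r h) (d : s h = r k),
    mul (mul g h c) k ((s_mul g h c).trans d) = mul g (mul h k d) (c.trans (r_mul h k d).symm)
  one_mul : ∀ g, mul (one (r g)) g (s_one (r g)) = g
  mul_one : ∀ g, mul g (one (s g)) (r_one (s g)).symm = g
  inv_mul : ∀ g, mul (inv g) g (s_inv g) = one (s g)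
  mul_inv : ∀ g, mul g (inv g) (r_inv g).symm = one (r g)
  continuous_one : Continuous one
  continuous_inv : Continuous inv
  continuous_mul : Continuous
    (fun p : {p : Arr × Arr // s p.1 = r p.2} => mul p.1.1 p.1.2 p.2)
  isLocalHomeomorph_r : IsLocalHomeomorph r
  isLocalHomeomorph_s : IsLocalHomeomorph s
  [t2_obj : T2Space Obj]
  [locallyCompact_obj : LocallyCompactSpace Obj]

attribute [instance] EtaleGroupoid.topObj EtaleGroupoid.topArr EtaleGroupoid.t2_obj
  EtaleGroupoid.locallyCompact_obj

/-- A bisection (slice): an open set of arrows on which `r` and `s` are injective. -/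
structure EtaleGroupoid.IsBisection (H : EtaleGroupoid.{u}) (T : Set H.Arr) : Prop where
  isOpen : IsOpen T
  injOn_r : Set.InjOn H.r T
  injOn_s : Set.InjOn H.s T

/-- A set of objects is invariant if it contains the source of an arrow exactly when it contains
its range. -/
def EtaleGroupoid.IsInvariant (G : EtaleGroupoid.{u}) (R : Set G.Obj) : Prop :=
  ∀ g, G.s g ∈ R ↔ G.r g ∈ R

/-- A left action of `G` on a topological space `Y`. -/
@[ext]
structure LeftAction (G : EtaleGroupoid.{u}) (Y : Type u) [TopologicalSpace Y] : Type u where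
  anchor : Y → G.Obj
  smul : (g : G.Arr) → (y : Y) → G.s g = anchor y → Y
  continuous_anchor : Continuous anchor
  continuous_smul : Continuous
    (fun p : {p : G.Arr × Y // G.s p.1 = anchor p.2} => smul p.1.1 p.1.2 p.2)
  anchor_smul : ∀ g y (c : G.s g = anchor y), anchor (smul g y c) = G.r g
  mul_smul : ∀ g h y (c : G.s g = G.r h) (d : G.s h = anchor y),
    smul (G.mul g h c) y ((G.s_mul g h c).trans d) =
      smul g (smul h y d) (c.trans (anchor_smul h y d).symm)
  one_smul : ∀ y, smul (G.one (anchor y)) y (G.s_one (anchor y)) = y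

/-- `φ` is equivariant for left actions of `G`. -/
def LeftAction.Equivariant {G : EtaleGroupoid.{u}} {Y₁ Y₂ : Type u} [TopologicalSpace Y₁]
    [TopologicalSpace Y₂] (a₁ : LeftAction G Y₁) (a₂ : LeftAction G Y₂) (φ : Y₁ → Y₂) : Prop :=
  ∃ hφ : ∀ y, a₂.anchor (φ y) = a₁.anchor y,
    ∀ g y (c : G.s g = a₁.anchor y), φ (a₁.smul g y c) = a₂.smul g (φ y) (c.trans (hφ y).symm)

/-- A right action of `G` on a topological space `Y`. -/
@[ext]
structure RightAction (G : EtaleGroupoid.{u}) (Y : Type u) [TopologicalSpace Y] : Type u where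
  anchor : Y → G.Obj
  act : (y : Y) → (g : G.Arr) → anchor y = G.r g → Y
  continuous_anchor : Continuous anchor
  continuous_act : Continuous
    (fun p : {p : Y × G.Arr // anchor p.1 = G.r p.2} => act p.1.1 p.1.2 p.2)
  anchor_act : ∀ y g (c : anchor y = G.r g), anchor (act y g c) = G.s g
  act_mul : ∀ y g h (c : anchor y = G.r g) (d : G.s g = G.r h),
    act y (G.mul g h d) (c.trans (G.r_mul g h d).symm) =
      act (act y g c) h ((anchor_act y g c).trans d)
  act_one : ∀ y, act y (G.one (anchor y)) (G.r_one (anchor y)).symm = y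

/-- A left action of `G` and a right action of `H` on the same space commute. -/
structure ActionsCommute {G H : EtaleGroupoid.{u}} {Y : Type u} [TopologicalSpace Y]
    (a : LeftAction G Y) (b : RightAction H Y) : Prop where
  right_anchor_smul : ∀ g y (c : G.s g = a.anchor y), b.anchor (a.smul g y c) = b.anchor y
  left_anchor_act : ∀ y h (c : b.anchor y = H.r h), a.anchor (b.act y h c) = a.anchor y
  smul_act : ∀ g y h (c : G.s g = a.anchor y) (d : b.anchor y = H.r h),
    b.act (a.smul g y c) h ((right_anchor_smul g y c).trans d) =
      a.smul g (b.act y h d) (c.trans (left_anchor_act y h d).symm)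

/-- The orbit equivalence relation of a right action. -/
def RightAction.orbitSetoid {G : EtaleGroupoid.{u}} {Y : Type u} [TopologicalSpace Y]
    (b : RightAction G Y) : Setoid Y where
  r y y' := ∃ (g : G.Arr) (c : b.anchor y = G.r g), b.act y g c = y'
  iseqv := by
    refine ⟨fun y => ⟨_, _, b.act_one y⟩, ?_, ?_⟩
    · rintro y _ ⟨g, c, rfl⟩
      refine ⟨G.inv g, (b.anchor_act y g c).trans (G.r_inv g).symm, ?_⟩
      rw [← b.act_mul y g (G.inv g) c (G.r_inv g).symm]
      have key : ∀ k (hk : b.anchor y = G.r k), k = G.one (b.anchor y) → b.act y k hk = y := by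
        rintro k hk rfl
        exact b.act_one y
      exact key _ _ ((G.mul_inv g).trans (congrArg G.one c.symm))
    · rintro y _ _ ⟨g, c, rfl⟩ ⟨h, d, rfl⟩
      exact ⟨G.mul g h ((b.anchor_act y g c).symm.trans d), _, b.act_mul y g h c _⟩

/-- The orbit space `Y / G` of a right action, with the quotient topology. -/
abbrev RightAction.OrbitSpace {G : EtaleGroupoid.{u}} {Y : Type u} [TopologicalSpace Y]
    (b : RightAction G Y) : Type u :=
  Quotient b.orbitSetoid

/-- An (étale, locally compact) groupoid correspondence `G ← H`: a space with commuting actions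
of `G` on the left and `H` on the right, such that the right action is free and proper and its
anchor map is a local homeomorphism. -/
structure Correspondence (G H : EtaleGroupoid.{u}) : Type (u + 1) where
  X : Type u
  [top : TopologicalSpace X]
  left : LeftAction G X
  right : RightAction H X
  commute : ActionsCommute left right
  free : ∀ x h (c : right.anchor x = H.r h), right.act x h c = x → h = H.one (right.anchor x)
  proper : IsProperMap
    (fun p : {p : X × H.Arr // right.anchor p.1 = H.r p.2} =>
      (right.act p.1.1 p.1.2 p.2, p.1.1))
  isLocalHomeomorph_right_anchor : IsLocalHomeomorph right.anchor

attribute [instance] Correspondence.top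

namespace Correspondence

variable {G H : EtaleGroupoid.{u}}

/-- The map `X / H → G⁰` induced by the left anchor map. -/
def rStar (X : Correspondence G H) : X.right.OrbitSpace → G.Obj :=
  Quotient.lift X.left.anchor (by
    rintro x _ ⟨h, c, rfl⟩
    exact (X.commute.left_anchor_act x h c).symm)

/-- `X` is regular on `R`: the restriction `r_*⁻¹(R) → R` of the map `r_* : X / H → G⁰` is proper
and surjective. -/
def IsRegularOn (X : Correspondence G H) (R : Set G.Obj) : Prop :=
  IsProperMap (R.restrictPreimage X.rStar) ∧ Function.Surjective (R.restrictPreimage X.rStar)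

end Correspondence

/-- A groupoid `G`, a correspondence `X : G ← G` and an open `G`-invariant set `R` of objects such
that `X` is regular on `R`. -/
structure RelativeCorrespondence : Type (u + 1) where
  G : EtaleGroupoid.{u}
  X : Correspondence G G
  R : Set G.Obj
  isOpen_R : IsOpen R
  isInvariant_R : G.IsInvariant R
  isRegularOn_R : X.IsRegularOn R

/-- An action of `(G, X, R)` on a topological space `Y`. -/
@[ext]
structure RelativeCorrespondence.Action (C : RelativeCorrespondence.{u}) (Y : Type u)
    [TopologicalSpace Y] : Type u extends LeftAction C.G Y where
  mul : (x : C.X.X) → (y : Y) → C.X.right.anchor x = anchor y → Y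
  continuous_mul : Continuous
    (fun p : {p : C.X.X × Y // C.X.right.anchor p.1 = anchor p.2} => mul p.1.1 p.1.2 p.2)
  isOpenMap_mul : IsOpenMap
    (fun p : {p : C.X.X × Y // C.X.right.anchor p.1 = anchor p.2} => mul p.1.1 p.1.2 p.2)
  anchor_mul : ∀ x y (c : C.X.right.anchor x = anchor y),
    anchor (mul x y c) = C.X.left.anchor x
  smul_mul : ∀ g x y (c : C.G.s g = C.X.left.anchor x) (d : C.X.right.anchor x = anchor y),
    smul g (mul x y d) (c.trans (anchor_mul x y d).symm) =
      mul (C.X.left.smul g x c) y ((C.X.commute.right_anchor_smul g x c).trans d)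
  mul_eq_mul_iff : ∀ x y x' y' (c : C.X.right.anchor x = anchor y)
    (c' : C.X.right.anchor x' = anchor y'),
    mul x y c = mul x' y' c' ↔
      ∃ (g : C.G.Arr) (d : C.X.right.anchor x = C.G.r g) (d' : C.G.s g = anchor y'),
        x' = C.X.right.act x g d ∧ y = smul g y' d'
  exists_mul_eq : ∀ y, anchor y ∈ C.R → ∃ x y' c, mul x y' c = y
  isClosed_mul : ∀ K : Set C.X.right.OrbitSpace, IsCompact K →
    IsClosed {z : Y | ∃ x y c, (Quotient.mk C.X.right.orbitSetoid x) ∈ K ∧ mul x y c = z}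

/-- The set `X · Y` of all products `x · y`. -/
def RelativeCorrespondence.Action.productSet {C : RelativeCorrespondence.{u}} {Y : Type u}
    [TopologicalSpace Y] (b : C.Action Y) : Set Y :=
  {z | ∃ x y c, b.mul x y c = z}

/-- `φ` is `(G, X)`-equivariant. -/
def RelativeCorrespondence.Action.Equivariant {C : RelativeCorrespondence.{u}} {Y₁ Y₂ : Type u}
    [TopologicalSpace Y₁] [TopologicalSpace Y₂] (b₁ : C.Action Y₁) (b₂ : C.Action Y₂)
    (φ : Y₁ → Y₂) : Prop :=
  b₁.toLeftAction.Equivariant b₂.toLeftAction φ ∧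
  (∀ x y (c : C.X.right.anchor x = b₁.anchor y) (c' : C.X.right.anchor x = b₂.anchor (φ y)),
    φ (b₁.mul x y c) = b₂.mul x (φ y) c') ∧
  φ ⁻¹' b₂.productSet = b₁.productSet

/-- The étale groupoid `M`, with the bijections `actionEquiv`, is a groupoid model of `(G, X, R)`:
`M`-actions on any topological space `Y` correspond bijectively to `(G, X, R)`-actions on `Y`, such
that a continuous map is equivariant for actions of `(G, X)` if and only if it is equivariant for
the associated actions of `M`. -/
structure GroupoidModel (C : RelativeCorrespondence.{u}) (M : EtaleGroupoid.{u}) :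
    Type (u + 1) where
  actionEquiv : (Y : Type u) → [TopologicalSpace Y] → LeftAction M Y ≃ C.Action Y
  equivariant_iff : ∀ {Y₁ Y₂ : Type u} [TopologicalSpace Y₁] [TopologicalSpace Y₂]
    (a₁ : LeftAction M Y₁) (a₂ : LeftAction M Y₂) (φ : Y₁ → Y₂), Continuous φ →
    ((actionEquiv Y₁ a₁).Equivariant (actionEquiv Y₂ a₂) φ ↔ a₁.Equivariant a₂ φ)

/-- The right translation action of a groupoid on its arrow space. -/
def EtaleGroupoid.rightTranslation (H : EtaleGroupoid.{u}) : RightAction H H.Arr where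
  anchor := H.s
  act := H.mul
  continuous_anchor := H.isLocalHomeomorph_s.continuous
  continuous_act := H.continuous_mul
  anchor_act := H.s_mul
  act_mul g h k c d := (H.mul_assoc g h k c d).symm
  act_one := H.mul_one

/-- An actor `M → H`: an action of `M` on the arrow space of `H` that commutes with the right
translation action of `H`. -/
@[ext]
structure Actor (M H : EtaleGroupoid.{u}) : Type u extends LeftAction M H.Arr where
  commute : ActionsCommute toLeftAction H.rightTranslation

/-- An actor is proper if the map `H⁰ ≅ H / H → M⁰` induced by its anchor map is proper.  The
identification `H⁰ ≅ H / H` sends an object to the orbit of its unit arrow. -/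
def Actor.IsProper {M H : EtaleGroupoid.{u}} (A : Actor M H) : Prop :=
  IsProperMap (fun ω : H.Obj => A.anchor (H.one ω))

/-- A set viewed as a discrete groupoid with only identity arrows. -/
def discreteGroupoid (V : Type u) : EtaleGroupoid.{u} :=
  letI : TopologicalSpace V := ⊥
  haveI : DiscreteTopology V := ⟨rfl⟩
  { Obj := V
    Arr := V
    r := id
    s := id
    one := id
    inv := id
    mul := fun g _ _ => g
    r_one := fun _ => rfl
    s_one := fun _ => rfl
    r_inv := fun _ => rfl
    s_inv := fun _ => rfl
    r_mul := fun _ _ _ => rfl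
    s_mul := fun _ _ c => c
    mul_assoc := fun _ _ _ _ _ => rfl
    one_mul := fun _ => rfl
    mul_one := fun _ => rfl
    inv_mul := fun _ => rfl
    mul_inv := fun _ => rfl
    continuous_one := continuous_id
    continuous_inv := continuous_id
    continuous_mul := continuous_of_discreteTopology
    isLocalHomeomorph_r := (Homeomorph.refl V).isLocalHomeomorph
    isLocalHomeomorph_s := (Homeomorph.refl V).isLocalHomeomorph }

/-- A directed graph; loops, multiple edges and infinitely many vertices or edges are allowed. -/
structure DirectedGraph : Type (u + 1) where
  V : Type u
  E : Type u
  r : E → V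
  s : E → V

namespace DirectedGraph

variable (Γ : DirectedGraph.{u})

/-- A vertex is regular if the set of edges with range `v` is finite and nonempty. -/
def regularVertices : Set Γ.V :=
  {v | (Γ.r ⁻¹' {v}).Finite ∧ (Γ.r ⁻¹' {v}).Nonempty}

/-- The discrete set of edges as a groupoid correspondence on the discrete set of vertices. -/
def correspondence : Correspondence (discreteGroupoid Γ.V) (discreteGroupoid Γ.V) :=
  letI : TopologicalSpace Γ.E := ⊥
  haveI : DiscreteTopology Γ.E := ⟨rfl⟩
  haveI : DiscreteTopology (discreteGroupoid Γ.V).Obj := ⟨rfl⟩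
  haveI : DiscreteTopology (discreteGroupoid Γ.V).Arr := ⟨rfl⟩
  { X := Γ.E
    left :=
      { anchor := Γ.r
        smul := fun _ e _ => e
        continuous_anchor := continuous_of_discreteTopology
        continuous_smul := continuous_of_discreteTopology
        anchor_smul := fun _ _ c => c.symm
        mul_smul := fun _ _ _ _ _ => rfl
        one_smul := fun _ => rfl }
    right :=
      { anchor := Γ.s
        act := fun e _ _ => e
        continuous_anchor := continuous_of_discreteTopology
        continuous_act := continuous_of_discreteTopology
        anchor_act := fun _ _ c => c
        act_mul := fun _ _ _ _ _ => rfl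
        act_one := fun _ => rfl }
    commute := ⟨fun _ _ _ => rfl, fun _ _ _ => rfl, fun _ _ _ _ _ => rfl⟩
    free := fun _ _ c _ => c.symm
    proper := by
      refine (IsClosedEmbedding.of_continuous_injective_isClosedMap
        continuous_of_discreteTopology ?_ (fun _ _ => isClosed_discrete _)).isProperMap
      rintro ⟨⟨e, v⟩, c⟩ ⟨⟨e', v'⟩, c'⟩ h
      obtain rfl : e = e' := congrArg Prod.fst h
      obtain rfl : v = v' := c.symm.trans c'
      rfl
    isLocalHomeomorph_right_anchor := by
      rw [isLocalHomeomorph_iff_isOpenEmbedding_restrict]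
      refine fun e => ⟨{e}, (isOpen_discrete _).mem_nhds rfl, ?_⟩
      refine IsOpenEmbedding.of_continuous_injective_isOpenMap
        continuous_of_discreteTopology ?_ (fun _ _ => isOpen_discrete _)
      rintro ⟨x, rfl⟩ ⟨y, rfl⟩ _
      rfl }

theorem isRegularOn_regularVertices : Γ.correspondence.IsRegularOn Γ.regularVertices := by
  have : DiscreteTopology (discreteGroupoid Γ.V).Obj := ⟨rfl⟩
  have : DiscreteTopology Γ.correspondence.X := ⟨rfl⟩
  have : DiscreteTopology Γ.correspondence.right.OrbitSpace :=
    discreteTopology_iff_forall_isOpen.2 fun _ => isOpen_coinduced.2 (isOpen_discrete _)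
  refine ⟨?_, ?_⟩
  · rw [isProperMap_iff_isCompact_preimage]
    refine ⟨continuous_of_discreteTopology, fun K hK => ?_⟩
    refine Set.Finite.isCompact ?_
    have hK' : K.Finite := hK.finite_of_discrete
    refine Set.Finite.preimage' hK' ?_
    rintro ⟨v, hv⟩ -
    have hfin : (Quotient.mk Γ.correspondence.right.orbitSetoid '' (Γ.r ⁻¹' {v})).Finite :=
      hv.1.image _
    refine Set.Finite.of_finite_image (f := Subtype.val) (hfin.subset ?_)
      Subtype.val_injective.injOn
    rintro _ ⟨⟨x, hx⟩, hxv, rfl⟩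
    induction x using Quotient.inductionOn with
    | h e => exact ⟨e, congrArg Subtype.val hxv, rfl⟩
  · rintro ⟨v, hv⟩
    obtain ⟨e, he⟩ := hv.2
    refine ⟨⟨Quotient.mk Γ.correspondence.right.orbitSetoid e, ?_⟩, Subtype.ext he⟩
    have he' : Γ.r e = v := he
    change Γ.r e ∈ Γ.regularVertices
    rw [he']
    exact hv

/-- The graph, viewed as a groupoid correspondence, relative to its set of regular vertices. -/
def relativeCorrespondence : RelativeCorrespondence.{u} where
  G := discreteGroupoid Γ.V
  X := Γ.correspondence
  R := Γ.regularVertices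
  isOpen_R := by
    have : DiscreteTopology (discreteGroupoid Γ.V).Obj := ⟨rfl⟩
    exact isOpen_discrete _
  isInvariant_R := fun _ => Iff.rfl
  isRegularOn_R := Γ.isRegularOn_regularVertices

/-- A dynamical Cuntz–Krieger family of `Γ` in `H`; the unit space is identified with the object
space of `H`. -/
@[ext]
structure DynamicalCKFamily (H : EtaleGroupoid.{u}) : Type u where
  Ω : Γ.V → Set H.Obj
  T : Γ.E → Set H.Arr
  isOpen_Ω : ∀ v, IsOpen (Ω v)
  isCompact_Ω : ∀ v, IsCompact (Ω v)
  isBisection_T : ∀ e, H.IsBisection (T e)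
  disjoint_Ω : ∀ v w, v ≠ w → Ω v ∩ Ω w = ∅
  source_T : ∀ e, H.s '' T e = Ω (Γ.s e)
  range_T : ∀ e, H.r '' T e ⊆ Ω (Γ.r e)
  disjoint_range_T : ∀ e f, e ≠ f → (H.r '' T e) ∩ (H.r '' T f) = ∅
  iUnion_range_T : ∀ v ∈ Γ.regularVertices, (⋃ (e : Γ.E) (_ : Γ.r e = v), H.r '' T e) = Ω v

/-- The family is nondegenerate if the sets `Ω v` cover the unit space. -/
def DynamicalCKFamily.IsNondegenerate {Γ : DirectedGraph.{u}} {H : EtaleGroupoid.{u}}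
    (F : Γ.DynamicalCKFamily H) : Prop :=
  ⋃ v, F.Ω v = Set.univ

end DirectedGraph

/-! A groupoid model allows `M`-actions and their continuous equivariant maps to be traded for graph
actions and theirs. Right translation by an arrow `k` is a map only on the source fibre over `r(k)`.
So an action commutes with right translation when it restricts to every source fibre and all
translation maps out of the fibres are equivariant. In this form the condition passes through the
model in both directions (`isTranslationInvariant_of_actor`,
`actionsCommute_of_isTranslationInvariant`), and actors become translation invariant graph actions
on `H.Arr`.

Such an action satisfies `e · h = (e · 1_{r(h)}) h`, so it is determined by its anchor on units and
the arrows `e · 1_ω`. For fixed `e` these arrows form the bisection `T e`. Conversely, a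
nondegenerate family acts by multiplying `h` on the left by the unique arrow of `T e` with source
`r(h)`. These constructions are mutually inverse (`action_familyOfAction`,
`DynamicalCKFamily.IsNondegenerate.familyOfAction_action`).

It remains to match properness with compactness of the sets `Ω v`. Since `H⁰ → V` factors through
`M⁰ → V`, it suffices that `M⁰ → V` has compact fibres (`isCompact_objAction_anchor_preimage`). The
space `M⁰` is terminal among graph actions. The ultrafilters on `M⁰` that contain a fibre of `M⁰ →
V` form a graph action with compact fibres, and its canonical map to `M⁰` sends each principal
ultrafilter to its point. Hence it carries each compact fibre onto the corresponding fibre of `M⁰`.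
-/

namespace DirectedGraph

variable {Γ : DirectedGraph.{u}}

/-! ### Graph actions in terms of single edges. -/

instance : DiscreteTopology Γ.relativeCorrespondence.X.X := ⟨rfl⟩

instance : DiscreteTopology Γ.relativeCorrespondence.G.Obj := ⟨rfl⟩

instance : DiscreteTopology Γ.relativeCorrespondence.G.Arr := ⟨rfl⟩

instance : DiscreteTopology Γ.relativeCorrespondence.X.right.OrbitSpace :=
  discreteTopology_iff_forall_isOpen.2 fun _ => isOpen_coinduced.2 (isOpen_discrete _)

/-- Only identity arrows act, so an orbit is a single edge. Compact sets of orbits thus amount to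
finite sets of edges. -/
theorem mk_orbitSetoid_injective :
    Function.Injective (Quotient.mk Γ.relativeCorrespondence.X.right.orbitSetoid) := by
  intro e e' h
  obtain ⟨_, _, rfl⟩ := Quotient.exact h
  rfl

/-- The embedding of the fibre over `e` into the fibre product of `Γ.E` and `Y` over `Γ.V`. -/
theorem isOpenEmbedding_edgeFibre {Y : Type u} [TopologicalSpace Y] (ϱ : Y → Γ.V) (e : Γ.E) :
    IsOpenEmbedding (fun y : {y : Y // Γ.s e = ϱ y} =>
      (⟨(e, y.1), y.2⟩ : {p : Γ.relativeCorrespondence.X.X × Y //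
        Γ.relativeCorrespondence.X.right.anchor p.1 = ϱ p.2})) := by
  refine ⟨?_, ?_⟩
  · refine IsEmbedding.of_comp (g := fun p => p.1.2) (by fun_prop) (by fun_prop)
      IsEmbedding.subtypeVal
  · have : (Set.range fun y : {y : Y // Γ.s e = ϱ y} =>
        (⟨(e, y.1), y.2⟩ : {p : Γ.relativeCorrespondence.X.X × Y //
          Γ.relativeCorrespondence.X.right.anchor p.1 = ϱ p.2})) =
        (fun p => p.1.1) ⁻¹' {e} := by
      ext ⟨⟨e', y⟩, c⟩
      constructor
      · rintro ⟨z, hz⟩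
        exact (congrArg (fun p => p.1.1) hz).symm
      · intro h
        obtain rfl : e' = e := h
        exact ⟨⟨y, c⟩, rfl⟩
    rw [this]
    exact (isOpen_discrete (α := Γ.relativeCorrespondence.X.X) {e}).preimage
      (continuous_fst.comp continuous_subtype_val)

/-- A `Γ`-action assembled from the partial maps given by the individual edges. -/
def actionOfEdges {Y : Type u} [TopologicalSpace Y] (ϱ : Y → Γ.V)
    (m : ∀ e y, Γ.s e = ϱ y → Y) (hϱ : ∀ v, IsOpen (ϱ ⁻¹' {v}))
    (hcont : ∀ e, Continuous fun y : {y // Γ.s e = ϱ y} => m e y.1 y.2)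
    (hopen : ∀ e, IsOpenMap fun y : {y // Γ.s e = ϱ y} => m e y.1 y.2)
    (hr : ∀ e y c, ϱ (m e y c) = Γ.r e)
    (hinj : ∀ e y c e' y' c', m e y c = m e' y' c' → e = e' ∧ y = y')
    (hreg : ∀ y, ϱ y ∈ Γ.regularVertices → ∃ e y' c, m e y' c = y)
    (hclosed : ∀ e, IsClosed {z | ∃ y c, m e y c = z}) :
    Γ.relativeCorrespondence.Action Y where
  anchor := ϱ
  smul _ y _ := y
  continuous_anchor := continuous_discrete_rng.2 hϱ
  continuous_smul := by fun_prop
  anchor_smul _ _ c := c.symm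
  mul_smul _ _ _ _ _ := rfl
  one_smul _ := rfl
  mul := m
  continuous_mul := by
    rw [continuous_iff_continuousAt]
    rintro ⟨⟨e, y⟩, c⟩
    exact ((isOpenEmbedding_edgeFibre ϱ e).continuousAt_iff (x := ⟨y, c⟩)).1
      (hcont e).continuousAt
  isOpenMap_mul := by
    intro U hU
    have : (fun p : {p : Γ.relativeCorrespondence.X.X × Y //
          Γ.relativeCorrespondence.X.right.anchor p.1 = ϱ p.2} => m p.1.1 p.1.2 p.2) '' U =
        ⋃ e : Γ.E, (fun y : {y // Γ.s e = ϱ y} => m e y.1 y.2) ''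
          ((fun y => ⟨(e, y.1), y.2⟩) ⁻¹' U) := by
      ext z
      simp only [Set.mem_iUnion]
      constructor
      · rintro ⟨⟨⟨e, y⟩, c⟩, h, rfl⟩
        exact ⟨e, ⟨y, c⟩, h, rfl⟩
      · rintro ⟨e, y, h, rfl⟩
        exact ⟨_, h, rfl⟩
    rw [this]
    exact isOpen_iUnion fun e =>
      hopen e _ (hU.preimage (isOpenEmbedding_edgeFibre ϱ e).continuous)
  anchor_mul := hr
  smul_mul _ _ _ _ _ := rfl
  mul_eq_mul_iff := by
    intro e y e' y' c c'
    constructor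
    · intro h
      obtain ⟨rfl, rfl⟩ := hinj _ _ _ _ _ _ h
      exact ⟨Γ.s e, rfl, c, rfl, rfl⟩
    · rintro ⟨g, d, d', h, rfl⟩
      obtain rfl : e' = e := h
      rfl
  exists_mul_eq := hreg
  isClosed_mul := by
    intro K hK
    have hfin : (Quotient.mk Γ.relativeCorrespondence.X.right.orbitSetoid ⁻¹' K).Finite :=
      hK.finite_of_discrete.preimage mk_orbitSetoid_injective.injOn
    have : {z : Y | ∃ (x : Γ.relativeCorrespondence.X.X) (y : Y)
          (c : Γ.relativeCorrespondence.X.right.anchor x = ϱ y),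
          Quotient.mk Γ.relativeCorrespondence.X.right.orbitSetoid x ∈ K ∧ m x y c = z} =
        ⋃ e ∈ Quotient.mk Γ.relativeCorrespondence.X.right.orbitSetoid ⁻¹' K,
          {z | ∃ y c, m e y c = z} := by
      ext z
      simp only [Set.mem_iUnion]
      constructor
      · rintro ⟨e, y, c, h, rfl⟩
        exact ⟨e, h, y, c, rfl⟩
      · rintro ⟨e, h, y, c, rfl⟩
        exact ⟨e, y, c, h, rfl⟩
    refine this ▸ ?_
    exact hfin.isClosed_biUnion fun e _ => hclosed e

section Action

variable {Y : Type u} [TopologicalSpace Y] (b : Γ.relativeCorrespondence.Action Y)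

theorem smul_eq (g y c) : b.smul g y c = y := by
  obtain rfl : g = b.anchor y := c
  exact b.one_smul y

theorem mul_injective {e : Γ.E} {y : Y} {c : Γ.s e = b.anchor y} {e' : Γ.E} {y' : Y}
    {c' : Γ.s e' = b.anchor y'} (h : b.mul e y c = b.mul e' y' c') : e = e' ∧ y = y' := by
  obtain ⟨g, d, d', h₁, h₂⟩ := (b.mul_eq_mul_iff _ _ _ _ _ _).1 h
  exact ⟨h₁.symm, h₂.trans (smul_eq b _ _ _)⟩

theorem continuous_mul_edge (e : Γ.E) :
    Continuous fun y : {y // Γ.s e = b.anchor y} => b.mul e y.1 y.2 :=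
  b.continuous_mul.comp (isOpenEmbedding_edgeFibre b.anchor e).continuous

theorem isOpenMap_mul_edge (e : Γ.E) :
    IsOpenMap fun y : {y // Γ.s e = b.anchor y} => b.mul e y.1 y.2 :=
  b.isOpenMap_mul.comp (isOpenEmbedding_edgeFibre b.anchor e).isOpenMap

theorem isClosed_range_mul_edge (e : Γ.E) :
    IsClosed {z | ∃ (y : Y) (c : Γ.s e = b.anchor y), b.mul e y c = z} := by
  convert b.isClosed_mul {Quotient.mk _ e} isCompact_singleton using 1
  ext z
  constructor
  · rintro ⟨y, c, h⟩
    exact ⟨e, y, c, rfl, h⟩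
  · rintro ⟨e', y, c, h, h'⟩
    obtain rfl : e' = e := mk_orbitSetoid_injective h
    exact ⟨y, c, h'⟩

theorem isOpen_anchor_preimage (v : Γ.V) : IsOpen (b.anchor ⁻¹' {v}) :=
  continuous_discrete_rng.1 b.continuous_anchor v

/-- The discrete groupoid acts by identities, so an action carries no data beyond its anchor and its
edge maps. -/
theorem action_ext {b b' : Γ.relativeCorrespondence.Action Y}
    (h : ∀ y, b.anchor y = b'.anchor y)
    (hm : ∀ (e : Γ.E) y (c : Γ.s e = b.anchor y) (c' : Γ.s e = b'.anchor y),
      b.mul e y c = b'.mul e y c') : b = b' := by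
  have hanchor : b.anchor = b'.anchor := funext h
  refine RelativeCorrespondence.Action.ext hanchor ?_ ?_
  · refine Function.hfunext rfl fun g _ hg => Function.hfunext rfl fun y _ hy => ?_
    obtain rfl := eq_of_heq hg
    obtain rfl := eq_of_heq hy
    refine Function.hfunext (by rw [hanchor]) fun c c' _ => heq_of_eq ?_
    rw [smul_eq, smul_eq]
  · refine Function.hfunext rfl fun e _ he => Function.hfunext rfl fun y _ hy => ?_
    obtain rfl := eq_of_heq he
    obtain rfl := eq_of_heq hy
    exact Function.hfunext (by rw [hanchor]) fun c c' _ => heq_of_eq (hm _ _ _ _)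

/-- Compatibility with edges already gives one inclusion between the product sets; `hp` supplies the
other. -/
theorem equivariant_of_edges {Y' : Type u} [TopologicalSpace Y']
    {b : Γ.relativeCorrespondence.Action Y} {b' : Γ.relativeCorrespondence.Action Y'} {φ : Y → Y'}
    (h : ∀ y, b'.anchor (φ y) = b.anchor y)
    (hm : ∀ (e : Γ.E) y (c : Γ.s e = b.anchor y) (c' : Γ.s e = b'.anchor (φ y)),
      φ (b.mul e y c) = b'.mul e (φ y) c')
    (hp : ∀ y (e : Γ.E) z (c : Γ.s e = b'.anchor z), b'.mul e z c = φ y →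
      y ∈ b.productSet) :
    b.Equivariant b' φ := by
  refine ⟨⟨h, fun g y c => ?_⟩, hm, ?_⟩
  · rw [smul_eq, smul_eq]
  · ext y
    constructor
    · rintro ⟨e, z, c, hz⟩
      exact hp y e z c hz
    · rintro ⟨e, z, c, rfl⟩
      exact ⟨e, φ z, c.trans (h z).symm, (hm e z c _).symm⟩

/-- The restriction of a `Γ`-action to a subset which is invariant in both directions. -/
def restrictAction (p : Set Y)
    (hp : ∀ (e : Γ.E) y (c : Γ.s e = b.anchor y), b.mul e y c ∈ p ↔ y ∈ p) :
    Γ.relativeCorrespondence.Action p :=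
  actionOfEdges (fun y => b.anchor y.1) (fun e y c => ⟨b.mul e y.1 c, (hp _ _ _).2 y.2⟩)
    (fun v => (isOpen_anchor_preimage b v).preimage continuous_subtype_val)
    (fun e => by
      have : Continuous fun y : {y : p // Γ.s e = b.anchor y.1} =>
          (⟨y.1.1, y.2⟩ : {y // Γ.s e = b.anchor y}) := by fun_prop
      exact Continuous.subtype_mk ((continuous_mul_edge b e).comp this) _)
    (fun e U hU => by
      obtain ⟨W, hW, rfl⟩ := isOpen_induced_iff.1 hU
      obtain ⟨W', hW', rfl⟩ := isOpen_induced_iff.1 hW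
      refine isOpen_induced_iff.2 ⟨_, isOpenMap_mul_edge b e _
        (hW'.preimage continuous_subtype_val), ?_⟩
      ext ⟨z, hz⟩
      constructor
      · rintro ⟨⟨y, c⟩, hy, rfl⟩
        exact ⟨⟨⟨y, (hp _ _ _).1 hz⟩, c⟩, hy, rfl⟩
      · rintro ⟨⟨⟨y, hy'⟩, c⟩, hy, h⟩
        exact ⟨⟨y, c⟩, hy, congrArg Subtype.val h⟩)
    (fun e y c => b.anchor_mul e y.1 c)
    (fun e y c e' y' c' h => by
      obtain ⟨h₁, h₂⟩ := mul_injective b (congrArg Subtype.val h)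
      exact ⟨h₁, Subtype.ext h₂⟩)
    (fun y hy => by
      obtain ⟨e, z, c, h⟩ := b.exists_mul_eq y.1 hy
      exact ⟨e, ⟨z, (hp e z c).1 (h ▸ y.2)⟩, c, Subtype.ext h⟩)
    (fun e => by
      convert (isClosed_range_mul_edge b e).preimage (continuous_subtype_val (p := (· ∈ p))) using 1
      ext ⟨z, hz⟩
      constructor
      · rintro ⟨y, c, h⟩
        exact ⟨y.1, c, congrArg Subtype.val h⟩
      · rintro ⟨y, c, h⟩
        obtain rfl : _ = z := h
        exact ⟨⟨y, (hp _ _ _).1 hz⟩, c, rfl⟩)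

end Action

end DirectedGraph

/-! ### Restricted groupoid actions and the terminal action on objects. -/

/-- The restriction of a left action to an invariant subset. -/
def LeftAction.restrict {G : EtaleGroupoid.{u}} {Y : Type u} [TopologicalSpace Y]
    (a : LeftAction G Y) (p : Set Y) (hp : ∀ g y c, y ∈ p → a.smul g y c ∈ p) :
    LeftAction G p where
  anchor y := a.anchor y.1
  smul g y c := ⟨a.smul g y.1 c, hp _ _ _ y.2⟩
  continuous_anchor := a.continuous_anchor.comp continuous_subtype_val
  continuous_smul := by
    have : Continuous fun q : {q : G.Arr × p // G.s q.1 = a.anchor q.2.1} =>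
        (⟨(q.1.1, q.1.2.1), q.2⟩ : {q : G.Arr × Y // G.s q.1 = a.anchor q.2}) := by fun_prop
    exact Continuous.subtype_mk (a.continuous_smul.comp this) _
  anchor_smul g y c := a.anchor_smul g y.1 c
  mul_smul g h y c d := Subtype.ext (a.mul_smul g h y.1 c d)
  one_smul y := Subtype.ext (a.one_smul y.1)

/-- The canonical left action of a groupoid on its objects. -/
def EtaleGroupoid.objAction (G : EtaleGroupoid.{u}) : LeftAction G G.Obj where
  anchor := id
  smul g _ _ := G.r g
  continuous_anchor := continuous_id
  continuous_smul := G.isLocalHomeomorph_r.continuous.comp (by fun_prop)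
  anchor_smul _ _ _ := rfl
  mul_smul g h _ c _ := G.r_mul g h c
  one_smul y := G.r_one y

/-- The object space is terminal: the anchor of `G.objAction` is the identity, so preserving anchors
leaves no choice. -/
theorem LeftAction.equivariant_objAction_iff {G : EtaleGroupoid.{u}} {Y : Type u}
    [TopologicalSpace Y] (a : LeftAction G Y) (φ : Y → G.Obj) :
    a.Equivariant G.objAction φ ↔ φ = a.anchor := by
  constructor
  · rintro ⟨h, -⟩
    exact funext h
  · rintro rfl
    exact ⟨fun _ => rfl, fun g y c => a.anchor_smul g y c⟩

/-! ### Actors as translation invariant graph actions. -/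

namespace DirectedGraph

variable {Γ : DirectedGraph.{u}}

/-- A `Γ`-action on the arrow space of `H` that commutes with the right translation action. -/
structure IsTranslationInvariant {H : EtaleGroupoid.{u}}
    (b : Γ.relativeCorrespondence.Action H.Arr) : Prop where
  source_mul : ∀ (e : Γ.E) h (c : Γ.s e = b.anchor h), H.s (b.mul e h c) = H.s h
  anchor_mul_arr : ∀ h k (d : H.s h = H.r k), b.anchor (H.mul h k d) = b.anchor h
  mul_mul_arr : ∀ (e : Γ.E) h k (c : Γ.s e = b.anchor h) (d : H.s h = H.r k)
    (c' : Γ.s e = b.anchor (H.mul h k d)) (d' : H.s (b.mul e h c) = H.r k),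
    b.mul e (H.mul h k d) c' = H.mul (b.mul e h c) k d'

end DirectedGraph

namespace EtaleGroupoid

variable (H : EtaleGroupoid.{u})

theorem continuous_mul_right {x : H.Obj} (k : H.Arr) (hk : x = H.r k) :
    Continuous fun g : {g | H.s g = x} => H.mul g.1 k (g.2.trans hk) := by
  have : Continuous fun g : {g | H.s g = x} =>
      (⟨(g.1, k), g.2.trans hk⟩ : {p : H.Arr × H.Arr // H.s p.1 = H.r p.2}) := by fun_prop
  exact H.continuous_mul.comp this

theorem mul_mul_inv (g k : H.Arr) (c : H.s g = H.r k)
    (d : H.s (H.mul g k c) = H.r (H.inv k)) : H.mul (H.mul g k c) (H.inv k) d = g := by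
  rw [H.mul_assoc g k (H.inv k) c (H.r_inv k).symm]
  have key : ∀ l (hl : H.s g = H.r l), l = H.one (H.s g) → H.mul g l hl = g := by
    rintro l hl rfl
    exact H.mul_one g
  exact key _ _ ((H.mul_inv k).trans (congrArg H.one c.symm))

end EtaleGroupoid

namespace DirectedGraph

variable {Γ : DirectedGraph.{u}} {M H : EtaleGroupoid.{u}}
  (𝓜 : GroupoidModel Γ.relativeCorrespondence M)

include 𝓜 in
-- The source fibres are `M`-invariant, and both their inclusions and the right translations out of
-- them are `M`-equivariant, hence equivariant for the graph.
theorem isTranslationInvariant_of_actor (A : Actor M H) :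
    IsTranslationInvariant (𝓜.actionEquiv H.Arr A.toLeftAction) := by
  set b := 𝓜.actionEquiv H.Arr A.toLeftAction with hb
  let a' (x : H.Obj) : LeftAction M {g | H.s g = x} :=
    A.toLeftAction.restrict {g | H.s g = x}
      fun g y c hy => (A.commute.right_anchor_smul g y c).trans hy
  -- The model gives no formula for the graph action on a fibre; equivariance of the inclusion
  -- identifies it with the restriction of `b`.
  have incl (x) : (𝓜.actionEquiv _ (a' x)).Equivariant b Subtype.val :=
    (𝓜.equivariant_iff _ _ _ continuous_subtype_val).2 ⟨fun _ => rfl, fun _ _ _ => rfl⟩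
  have trans (k : H.Arr) : (𝓜.actionEquiv _ (a' (H.r k))).Equivariant b
      fun g => H.mul g.1 k g.2 :=
    (𝓜.equivariant_iff _ _ _ (H.continuous_mul_right k rfl)).2
      ⟨fun g => A.commute.left_anchor_act g.1 k g.2,
        fun g y c => A.commute.smul_act g y.1 k c y.2⟩
  have hs : ∀ (e : Γ.E) h (c : Γ.s e = b.anchor h), H.s (b.mul e h c) = H.s h := by
    intro e h c
    have c' : Γ.s e = (𝓜.actionEquiv _ (a' (H.s h))).anchor ⟨h, rfl⟩ :=
      c.trans ((incl (H.s h)).1.1 ⟨h, rfl⟩)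
    rw [← (incl (H.s h)).2.1 e ⟨h, rfl⟩ c' c]
    exact Subtype.property (p := (· ∈ {g | H.s g = _})) _
  refine ⟨hs, fun h k d => ?_, fun e h k c d c' d' => ?_⟩
  · exact ((trans k).1.1 ⟨h, d⟩).trans ((incl (H.r k)).1.1 ⟨h, d⟩).symm
  · have c₁ : Γ.s e = (𝓜.actionEquiv _ (a' (H.r k))).anchor ⟨h, d⟩ :=
      c.trans ((incl (H.r k)).1.1 ⟨h, d⟩)
    have h₁ := (incl (H.r k)).2.1 e ⟨h, d⟩ c₁ c
    have h₂ := (trans k).2.1 e ⟨h, d⟩ c₁ c'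
    refine h₂.symm.trans ?_
    change H.mul _ _ _ = H.mul _ _ _
    congr 1

/-- The converse transfer: here the graph action is restricted to the source fibres, and the model
turns these restrictions into `M`-actions. -/
theorem actionsCommute_of_isTranslationInvariant (a : LeftAction M H.Arr)
    (hb : IsTranslationInvariant (𝓜.actionEquiv H.Arr a)) :
    ActionsCommute a H.rightTranslation := by
  set b := 𝓜.actionEquiv H.Arr a with hb'
  have hp (x : H.Obj) (e : Γ.E) (y) (c : Γ.s e = b.anchor y) :
      b.mul e y c ∈ {g | H.s g = x} ↔ y ∈ {g | H.s g = x} := by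
    simp only [Set.mem_ofPred_eq, hb.source_mul]
  let b' (x : H.Obj) := restrictAction b {g | H.s g = x} (hp x)
  let a' (x : H.Obj) := (𝓜.actionEquiv _).symm (b' x)
  have ha' (x) : 𝓜.actionEquiv _ (a' x) = b' x := Equiv.apply_symm_apply _ _
  have incl (x) : (a' x).Equivariant a Subtype.val := by
    rw [← 𝓜.equivariant_iff _ _ _ continuous_subtype_val, ha', ← hb']
    refine equivariant_of_edges (fun _ => rfl) (fun _ _ _ _ => rfl) ?_
    rintro y e z c h
    exact ⟨e, ⟨z, (hp x e z c).1 (h ▸ y.2)⟩, c, Subtype.ext h⟩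
  have trans (k : H.Arr) : (a' (H.r k)).Equivariant a fun g => H.mul g.1 k g.2 := by
    rw [← 𝓜.equivariant_iff _ _ _ (H.continuous_mul_right k rfl), ha', ← hb']
    refine equivariant_of_edges (fun g => hb.anchor_mul_arr g.1 k g.2)
      (fun e g c c' => (hb.mul_mul_arr e g.1 k c g.2 c' _).symm) ?_
    rintro ⟨y, hy⟩ e z c h
    -- For the product sets: `y k = e · z` forces `y = e · (z k⁻¹)`, where `z k⁻¹` lies in the same
    -- source fibre as `y`.
    have hz : H.s z = H.r (H.inv k) := by
      rw [← hb.source_mul e z c, h, H.s_mul, H.r_inv]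
    have c' : Γ.s e = b.anchor (H.mul z (H.inv k) hz) := by rw [hb.anchor_mul_arr, c]
    have d' : H.s (b.mul e z c) = H.r (H.inv k) := (hb.source_mul e z c).trans hz
    have key := hb.mul_mul_arr e z (H.inv k) c hz c' d'
    have hy' : H.mul (b.mul e z c) (H.inv k) d' = y := by
      simp only [h]
      exact H.mul_mul_inv y k hy _
    refine ⟨e, ⟨H.mul z (H.inv k) hz, ?_⟩, c', Subtype.ext (key.trans hy')⟩
    exact (H.s_mul _ _ _).trans (H.s_inv k)
  have hs : ∀ g y (c : M.s g = a.anchor y), H.s (a.smul g y c) = H.s y := by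
    intro g y c
    rw [← (incl (H.s y)).2 g ⟨y, rfl⟩ (c.trans ((incl (H.s y)).1 ⟨y, rfl⟩))]
    exact Subtype.property (p := (· ∈ {g | H.s g = _})) _
  have ha : ∀ y h (c : H.s y = H.r h), a.anchor (H.mul y h c) = a.anchor y := fun y h c =>
    ((trans h).1 ⟨y, c⟩).trans ((incl (H.r h)).1 ⟨y, c⟩).symm
  refine ⟨hs, ha, fun g y h c d => ?_⟩
  have c₁ := c.trans ((incl (H.r h)).1 ⟨y, d⟩)
  have h₁ := (incl (H.r h)).2 g ⟨y, d⟩ c₁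
  have h₂ := (trans h).2 g ⟨y, d⟩ c₁
  refine Eq.trans ?_ h₂
  change H.mul _ _ _ = H.mul _ _ _
  congr 1
  exact h₁.symm

end DirectedGraph

/-! ### Cancellation in groupoids and topology of bisections. -/

namespace EtaleGroupoid

variable {H : EtaleGroupoid.{u}}

/-- The unit map is a continuous section of the local homeomorphism `s`, hence itself a local
homeomorphism. -/
theorem isOpenMap_one : IsOpenMap H.one := by
  have h : IsLocalHomeomorph (H.s ∘ H.one) := by
    rw [show H.s ∘ H.one = id from funext H.s_one]
    exact (Homeomorph.refl _).isLocalHomeomorph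
  exact (h.of_comp H.isLocalHomeomorph_s H.continuous_one).isOpenMap

theorem mul_congr {g g' h h' : H.Arr} (hg : g = g') (hh : h = h') (c : H.s g = H.r h)
    (c' : H.s g' = H.r h') : H.mul g h c = H.mul g' h' c' := by
  subst hg hh
  rfl

theorem mul_one_of_eq (g : H.Arr) (ω : H.Obj) (c : H.s g = H.r (H.one ω)) :
    H.mul g (H.one ω) c = g := by
  obtain rfl : H.s g = ω := c.trans (H.r_one ω)
  exact H.mul_one g

theorem inv_mul_mul (g h : H.Arr) (c : H.s g = H.r h) (d : H.s (H.inv g) = H.r (H.mul g h c)) :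
    H.mul (H.inv g) (H.mul g h c) d = h := by
  rw [← H.mul_assoc (H.inv g) g h (H.s_inv g) c]
  have h₁ : H.mul (H.inv g) g (H.s_inv g) = H.one (H.r h) := by rw [H.inv_mul, c]
  exact (mul_congr h₁ rfl _ (H.s_one _)).trans (H.one_mul h)

theorem mul_inv_mul (g h : H.Arr) (c : H.s (H.inv g) = H.r h)
    (d : H.s g = H.r (H.mul (H.inv g) h c)) : H.mul g (H.mul (H.inv g) h c) d = h := by
  rw [← H.mul_assoc g (H.inv g) h (H.r_inv g).symm c]
  have h₁ : H.mul g (H.inv g) (H.r_inv g).symm = H.one (H.r h) := by rw [H.mul_inv, ← c, H.s_inv]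
  exact (mul_congr h₁ rfl _ (H.s_one _)).trans (H.one_mul h)

theorem mul_left_cancel {g h h' : H.Arr} {c : H.s g = H.r h} {c' : H.s g = H.r h'}
    (e : H.mul g h c = H.mul g h' c') : h = h' := by
  rw [← inv_mul_mul g h c ((H.s_inv g).trans (H.r_mul g h c).symm),
    ← inv_mul_mul g h' c' ((H.s_inv g).trans (H.r_mul g h' c').symm)]
  exact mul_congr rfl e _ _

theorem IsBisection.isInducing_r {T : Set H.Arr} (hT : H.IsBisection T) :
    IsInducing (fun t : T => H.r t) :=
  (IsOpenEmbedding.of_continuous_injective_isOpenMap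
    (H.isLocalHomeomorph_r.continuous.comp continuous_subtype_val) hT.injOn_r.injective
    (H.isLocalHomeomorph_r.isOpenMap.comp hT.isOpen.isOpenMap_subtype_val)).isInducing

theorem IsBisection.isOpenEmbedding_s {T : Set H.Arr} (hT : H.IsBisection T) :
    IsOpenEmbedding (fun t : T => H.s t) :=
  IsOpenEmbedding.of_continuous_injective_isOpenMap
    (H.isLocalHomeomorph_s.continuous.comp continuous_subtype_val) hT.injOn_s.injective
    (H.isLocalHomeomorph_s.isOpenMap.comp hT.isOpen.isOpenMap_subtype_val)

theorem IsBisection.continuous_of_r {T : Set H.Arr} (hT : H.IsBisection T) {Z : Type*}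
    [TopologicalSpace Z] {f : Z → H.Arr} (hf : ∀ z, f z ∈ T)
    (hc : Continuous fun z => H.r (f z)) : Continuous f :=
  continuous_subtype_val.comp
    (hT.isInducing_r.continuous_iff.2 hc : Continuous fun z => (⟨f z, hf z⟩ : T))

theorem IsBisection.continuous_of_s {T : Set H.Arr} (hT : H.IsBisection T) {Z : Type*}
    [TopologicalSpace Z] {f : Z → H.Arr} (hf : ∀ z, f z ∈ T)
    (hc : Continuous fun z => H.s (f z)) : Continuous f :=
  continuous_subtype_val.comp
    (hT.isOpenEmbedding_s.isInducing.continuous_iff.2 hc : Continuous fun z => (⟨f z, hf z⟩ : T))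

/-- The source map is a homeomorphism from a bisection onto its image. -/
theorem IsBisection.isCompact {T : Set H.Arr} (hT : H.IsBisection T)
    (hs : IsCompact (H.s '' T)) : IsCompact T := by
  rw [isCompact_iff_isCompact_univ, hT.isOpenEmbedding_s.isInducing.isCompact_iff]
  convert hs using 1
  rw [Set.image_univ]
  exact (Set.image_eq_range _ _).symm

theorem continuous_mul_of {Z : Type*} [TopologicalSpace Z] {f g : Z → H.Arr}
    (hf : Continuous f) (hg : Continuous g) (c : ∀ z, H.s (f z) = H.r (g z)) :
    Continuous fun z => H.mul (f z) (g z) (c z) := by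
  have : Continuous fun z =>
      (⟨(f z, g z), c z⟩ : {p : H.Arr × H.Arr // H.s p.1 = H.r p.2}) := by fun_prop
  exact H.continuous_mul.comp this

end EtaleGroupoid

/-! ### From translation invariant actions to Cuntz–Krieger families. -/

namespace DirectedGraph

variable {Γ : DirectedGraph.{u}} {H : EtaleGroupoid.{u}}

section FamilyOfAction

variable {b : Γ.relativeCorrespondence.Action H.Arr}

theorem IsTranslationInvariant.anchor_eq (hb : IsTranslationInvariant b) (h : H.Arr) :
    b.anchor h = b.anchor (H.one (H.r h)) := by
  rw [← hb.anchor_mul_arr (H.one (H.r h)) h (H.s_one _), H.one_mul]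

theorem IsTranslationInvariant.mul_eq_of (hb : IsTranslationInvariant b) {e : Γ.E} {h k g : H.Arr}
    {d : H.s h = H.r k} (hg : H.mul h k d = g) (c : Γ.s e = b.anchor h) (c' : Γ.s e = b.anchor g)
    (d' : H.s (b.mul e h c) = H.r k) : b.mul e g c' = H.mul (b.mul e h c) k d' := by
  subst hg
  exact hb.mul_mul_arr e h k c d c' d'

theorem IsTranslationInvariant.mul_eq (hb : IsTranslationInvariant b) (e : Γ.E) (h : H.Arr)
    (c : Γ.s e = b.anchor h) (c' : Γ.s e = b.anchor (H.one (H.r h)))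
    (d : H.s (b.mul e (H.one (H.r h)) c') = H.r h) :
    b.mul e h c = H.mul (b.mul e (H.one (H.r h)) c') h d :=
  hb.mul_eq_of (H.one_mul h) _ _ _

theorem IsTranslationInvariant.source_mul_one (hb : IsTranslationInvariant b) (e : Γ.E)
    (ω : H.Obj) (c : Γ.s e = b.anchor (H.one ω)) : H.s (b.mul e (H.one ω) c) = ω :=
  (hb.source_mul e _ c).trans (H.s_one ω)

/-- Put `t = e · 1_ω`, `t' = e' · 1_ω'` and `k = t⁻¹ t'`. Then `e · k = t k = t' = e' · 1_ω'`, so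
injectivity of the action gives `e = e'` and `k = 1_ω'`, while `r(k) = ω`. This yields both
injectivity of `r` on `T e` and disjointness of the ranges. -/
theorem IsTranslationInvariant.eq_of_range_mul_eq (hb : IsTranslationInvariant b) {e e' : Γ.E}
    {ω ω' : H.Obj} {c : Γ.s e = b.anchor (H.one ω)} {c' : Γ.s e' = b.anchor (H.one ω')}
    (h : H.r (b.mul e (H.one ω) c) = H.r (b.mul e' (H.one ω') c')) : e = e' ∧ ω = ω' := by
  set t := b.mul e (H.one ω) c with ht
  set t' := b.mul e' (H.one ω') c' with ht'
  have h₁ : H.s (H.inv t) = H.r t' := (H.s_inv t).trans h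
  set k := H.mul (H.inv t) t' h₁ with hk
  have hrk : H.r k = ω := by
    rw [hk, H.r_mul, H.r_inv, ht, hb.source_mul_one]
  have h₂ : H.mul t k ((hb.source_mul_one e ω c).trans hrk.symm) = t' := H.mul_inv_mul t t' h₁ _
  have h₃ : H.mul (H.one ω) k ((H.s_one ω).trans hrk.symm) = k := by
    refine (H.mul_congr (congrArg H.one hrk.symm) rfl _ (H.s_one _)).trans (H.one_mul k)
  have hck : Γ.s e = b.anchor k := by rw [c, hb.anchor_eq k, hrk]
  have h₄ : b.mul e k hck = b.mul e' (H.one ω') c' :=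
    (hb.mul_eq_of h₃ c hck ((hb.source_mul_one e ω c).trans hrk.symm)).trans h₂
  obtain ⟨h₅, h₆⟩ := mul_injective b h₄
  refine ⟨h₅, ?_⟩
  rw [← hrk, h₆, H.r_one]

/-- The dynamical Cuntz–Krieger family of a translation invariant `Γ`-action. -/
def familyOfAction (hb : IsTranslationInvariant b)
    (hc : ∀ v : Γ.V, IsCompact {ω | b.anchor (H.one ω) = v}) : Γ.DynamicalCKFamily H where
  Ω v := {ω | b.anchor (H.one ω) = v}
  T e := {h | ∃ (ω : H.Obj) (c : Γ.s e = b.anchor (H.one ω)), b.mul e (H.one ω) c = h}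
  isOpen_Ω v := (isOpen_anchor_preimage b v).preimage H.continuous_one
  isCompact_Ω := hc
  isBisection_T e := by
    refine ⟨?_, ?_, ?_⟩
    -- `T e` is the image under the open map `e · _` of the units in its domain, and the units form
    -- an open set.
    · convert isOpenMap_mul_edge b e _ ((H.isOpenMap_one _ isOpen_univ).preimage
        continuous_subtype_val) using 1
      ext h
      constructor
      · rintro ⟨ω, c, rfl⟩
        exact ⟨⟨_, c⟩, ⟨ω, trivial, rfl⟩, rfl⟩
      · rintro ⟨⟨_, c⟩, ⟨ω, -, rfl⟩, rfl⟩
        exact ⟨ω, c, rfl⟩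
    · rintro _ ⟨ω, c, rfl⟩ _ ⟨ω', c', rfl⟩ h
      obtain ⟨-, rfl⟩ := hb.eq_of_range_mul_eq h
      rfl
    · rintro _ ⟨ω, c, rfl⟩ _ ⟨ω', c', rfl⟩ h
      obtain rfl : ω = ω' := by
        rw [← hb.source_mul_one e ω c, h, hb.source_mul_one]
      rfl
  disjoint_Ω v w h := by
    refine Set.eq_empty_iff_forall_notMem.2 ?_
    rintro ω ⟨h₁, h₂⟩
    exact h (Eq.trans (Eq.symm h₁) h₂)
  source_T e := by
    ext ω
    constructor
    · rintro ⟨_, ⟨ω', c, rfl⟩, rfl⟩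
      rw [hb.source_mul_one]
      exact c.symm
    · intro h
      exact ⟨_, ⟨ω, Eq.symm h, rfl⟩, hb.source_mul_one _ _ _⟩
  range_T e := by
    rintro _ ⟨_, ⟨ω, c, rfl⟩, rfl⟩
    exact (hb.anchor_eq _).symm.trans (b.anchor_mul e _ c)
  disjoint_range_T e f hef := by
    refine Set.eq_empty_iff_forall_notMem.2 ?_
    rintro _ ⟨⟨_, ⟨ω, c, rfl⟩, rfl⟩, ⟨_, ⟨ω', c', rfl⟩, h⟩⟩
    exact hef (hb.eq_of_range_mul_eq h).1.symm
  iUnion_range_T v hv := by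
    ext ω
    simp only [Set.mem_iUnion]
    constructor
    · rintro ⟨e, rfl, _, ⟨ω, c, rfl⟩, rfl⟩
      exact (hb.anchor_eq _).symm.trans (b.anchor_mul e _ c)
    · intro h
      have h' : b.anchor (H.one ω) = v := h
      obtain ⟨e, k, c, hk⟩ := b.exists_mul_eq (H.one ω) (h'.symm ▸ hv)
      -- From `1_ω = e · k = (e · 1_{r(k)}) k` it follows that `ω` is the range of `e · 1_{r(k)}`,
      -- an element of `T e`.
      have c' : Γ.s e = b.anchor (H.one (H.r k)) := (hb.anchor_eq k) ▸ c
      refine ⟨e, (b.anchor_mul e k c).symm.trans (hk ▸ h'), _, ⟨H.r k, c', rfl⟩, ?_⟩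
      rw [← H.r_mul _ k (hb.source_mul_one e _ c'), ← hb.mul_eq e k c c', hk, H.r_one]

end FamilyOfAction

/-! ### From nondegenerate families to translation invariant actions. -/

section ActionOfFamily

namespace DynamicalCKFamily

variable (F : Γ.DynamicalCKFamily H)

theorem eq_of_mem {v w : Γ.V} {ω : H.Obj} (hv : ω ∈ F.Ω v) (hw : ω ∈ F.Ω w) : v = w := by
  by_contra h
  exact Set.eq_empty_iff_forall_notMem.1 (F.disjoint_Ω v w h) ω ⟨hv, hw⟩

theorem exists_mem_T {e : Γ.E} {ω : H.Obj} (h : ω ∈ F.Ω (Γ.s e)) : ∃ t ∈ F.T e, H.s t = ω := by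
  rwa [← F.source_T e] at h

/-- The arrow in `T e` with a given source. -/
noncomputable def lift (e : Γ.E) (ω : H.Obj) (h : ω ∈ F.Ω (Γ.s e)) : H.Arr :=
  (F.exists_mem_T h).choose

theorem lift_mem (e : Γ.E) (ω : H.Obj) (h : ω ∈ F.Ω (Γ.s e)) : F.lift e ω h ∈ F.T e :=
  (F.exists_mem_T h).choose_spec.1

theorem s_lift (e : Γ.E) (ω : H.Obj) (h : ω ∈ F.Ω (Γ.s e)) : H.s (F.lift e ω h) = ω :=
  (F.exists_mem_T h).choose_spec.2

theorem lift_eq {e : Γ.E} {t : H.Arr} (ht : t ∈ F.T e) {ω : H.Obj} (hω : H.s t = ω)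
    (h : ω ∈ F.Ω (Γ.s e)) : F.lift e ω h = t :=
  (F.isBisection_T e).injOn_s (F.lift_mem e _ h) ht ((F.s_lift e ω h).trans hω.symm)

theorem s_mem {e : Γ.E} {t : H.Arr} (ht : t ∈ F.T e) : H.s t ∈ F.Ω (Γ.s e) :=
  F.source_T e ▸ Set.mem_image_of_mem _ ht

/-- `T e` is compact because its source `Ω (Γ.s e)` is, and the object space is Hausdorff. This
gives the closedness axiom for the action. -/
theorem isClosed_range (e : Γ.E) : IsClosed (H.r '' F.T e) :=
  (((F.isBisection_T e).isCompact (F.source_T e ▸ F.isCompact_Ω _)).image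
    H.isLocalHomeomorph_r.continuous).isClosed

variable {F} (hF : F.IsNondegenerate)

include hF in
theorem IsNondegenerate.exists_mem (ω : H.Obj) : ∃ v, ω ∈ F.Ω v :=
  Set.mem_iUnion.1 (hF ▸ Set.mem_univ ω)

/-- The vertex whose set contains a given object. -/
noncomputable def IsNondegenerate.vertex (ω : H.Obj) : Γ.V := (hF.exists_mem ω).choose

theorem IsNondegenerate.vertex_eq_iff {ω : H.Obj} {v : Γ.V} : hF.vertex ω = v ↔ ω ∈ F.Ω v := by
  constructor
  · rintro rfl
    exact (hF.exists_mem ω).choose_spec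
  · exact F.eq_of_mem (hF.exists_mem ω).choose_spec

/-- The product of an edge and an arrow. -/
noncomputable def IsNondegenerate.edgeMul (e : Γ.E) (h : H.Arr) (c : Γ.s e = hF.vertex (H.r h)) :
    H.Arr :=
  H.mul (F.lift e (H.r h) (hF.vertex_eq_iff.1 c.symm)) h (F.s_lift _ _ _)

theorem IsNondegenerate.edgeMul_eq {e : Γ.E} {h : H.Arr} {c : Γ.s e = hF.vertex (H.r h)}
    {t : H.Arr} (ht : t ∈ F.T e) (hth : H.s t = H.r h) : hF.edgeMul e h c = H.mul t h hth :=
  H.mul_congr (F.lift_eq ht hth _) rfl _ _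

theorem IsNondegenerate.exists_edgeMul_eq {e : Γ.E} {z : H.Arr} {t : H.Arr} (ht : t ∈ F.T e)
    (htz : H.s (H.inv t) = H.r z) :
    ∃ c, hF.edgeMul e (H.mul (H.inv t) z htz) c = z := by
  have h : H.s t = H.r (H.mul (H.inv t) z htz) := by rw [H.r_mul, H.r_inv]
  refine ⟨(hF.vertex_eq_iff.2 (h ▸ F.s_mem ht)).symm, ?_⟩
  rw [hF.edgeMul_eq ht h, H.mul_inv_mul]

theorem IsNondegenerate.setOf_edgeMul_eq (e : Γ.E) :
    {z | ∃ h c, hF.edgeMul e h c = z} = H.r ⁻¹' (H.r '' F.T e) := by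
  ext z
  constructor
  · rintro ⟨h, c, rfl⟩
    exact ⟨_, F.lift_mem _ _ _, (H.r_mul _ _ _).symm⟩
  · rintro ⟨t, ht, htz⟩
    exact ⟨_, hF.exists_edgeMul_eq ht ((H.s_inv t).trans htz)⟩

/-- The range of a product is the range of its left factor. Disjoint ranges determine the edge,
injectivity of `r` on `T e` determines the left factor, and that factor cancels. -/
theorem IsNondegenerate.edgeMul_injective {e e' : Γ.E} {h h' : H.Arr}
    {c : Γ.s e = hF.vertex (H.r h)} {c' : Γ.s e' = hF.vertex (H.r h')}
    (heq : hF.edgeMul e h c = hF.edgeMul e' h' c') : e = e' ∧ h = h' := by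
  have hr := congrArg H.r heq
  simp only [edgeMul, H.r_mul] at hr
  obtain rfl : e = e' := by
    by_contra hne
    exact Set.eq_empty_iff_forall_notMem.1 (F.disjoint_range_T e e' hne) _
      ⟨⟨_, F.lift_mem _ _ _, rfl⟩, ⟨_, F.lift_mem _ _ _, hr.symm⟩⟩
  refine ⟨rfl, ?_⟩
  have ht := (F.isBisection_T e).injOn_r (F.lift_mem _ _ _) (F.lift_mem _ _ _) hr
  have hd : H.s (F.lift e (H.r h) (hF.vertex_eq_iff.1 c.symm)) = H.r h' := by
    rw [ht, F.s_lift]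
  refine EtaleGroupoid.mul_left_cancel (heq.trans (?_ : _ = H.mul _ h' hd))
  exact H.mul_congr ht.symm rfl _ _

/-- The `Γ`-action on arrows given by a nondegenerate dynamical Cuntz–Krieger family. -/
noncomputable def IsNondegenerate.action : Γ.relativeCorrespondence.Action H.Arr :=
  actionOfEdges (fun h => hF.vertex (H.r h)) hF.edgeMul
    (fun v => by
      convert (F.isOpen_Ω v).preimage H.isLocalHomeomorph_r.continuous using 1
      ext h
      exact hF.vertex_eq_iff)
    (fun e => by
      refine H.continuous_mul_of ((F.isBisection_T e).continuous_of_s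
        (fun _ => F.lift_mem _ _ _) ?_) continuous_subtype_val _
      simp only [F.s_lift]
      exact H.isLocalHomeomorph_r.continuous.comp continuous_subtype_val)
    (fun e U hU => by
      obtain ⟨U', hU', rfl⟩ := isOpen_induced_iff.1 hU
      -- On the open set `W` of all multiples of `e`, the inverse of multiplication by `e` is `z ↦
      -- t(z)⁻¹ z`, with `t(z)` the arrow of `T e` that has the range of `z`. It is continuous, so
      -- multiplication by `e` is open.
      let W : Set H.Arr := H.r ⁻¹' (H.r '' F.T e)
      have hW : IsOpen W := (H.isLocalHomeomorph_r.isOpenMap _ (F.isBisection_T e).isOpen).preimage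
        H.isLocalHomeomorph_r.continuous
      have hex : ∀ z : W, ∃ t ∈ F.T e, H.r t = H.r z := fun z => z.2
      choose t htT htr using hex
      have ht : Continuous t := (F.isBisection_T e).continuous_of_r htT (by
        simp only [htr]
        exact H.isLocalHomeomorph_r.continuous.comp continuous_subtype_val)
      have hc : ∀ z : W, H.s (H.inv (t z)) = H.r z := fun z => (H.s_inv _).trans (htr z)
      have hf : Continuous fun z : W => H.mul (H.inv (t z)) z (hc z) :=
        H.continuous_mul_of (H.continuous_inv.comp ht) continuous_subtype_val hc
      convert hW.isOpenMap_subtype_val _ (hU'.preimage hf) using 1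
      ext z
      constructor
      · rintro ⟨⟨h, c⟩, hh, rfl⟩
        have hzW : hF.edgeMul e h c ∈ W := ⟨_, F.lift_mem _ _ _, (H.r_mul _ _ _).symm⟩
        refine ⟨⟨_, hzW⟩, ?_, rfl⟩
        obtain ⟨c', h'⟩ := hF.exists_edgeMul_eq (htT ⟨_, hzW⟩) (hc ⟨_, hzW⟩)
        change H.mul _ _ _ ∈ U'
        rw [(hF.edgeMul_injective (c' := c) h').2]
        exact hh
      · rintro ⟨z, hz, rfl⟩
        obtain ⟨c', h'⟩ := hF.exists_edgeMul_eq (htT z) (hc z)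
        exact ⟨⟨_, c'⟩, hz, h'⟩)
    (fun e h c => hF.vertex_eq_iff.2 (F.range_T e ⟨_, F.lift_mem _ _ _, (H.r_mul _ _ _).symm⟩))
    (fun _ _ _ _ _ _ => hF.edgeMul_injective)
    (fun z hz => by
      have h : H.r z ∈ F.Ω (hF.vertex (H.r z)) := hF.vertex_eq_iff.1 rfl
      rw [← F.iUnion_range_T _ hz] at h
      simp only [Set.mem_iUnion] at h
      obtain ⟨e, -, h⟩ := h
      have h' : z ∈ {z | ∃ h c, hF.edgeMul e h c = z} := hF.setOf_edgeMul_eq e ▸ h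
      exact ⟨e, h'⟩)
    (fun e => by
      rw [hF.setOf_edgeMul_eq]
      exact (F.isClosed_range e).preimage H.isLocalHomeomorph_r.continuous)

theorem IsNondegenerate.isTranslationInvariant : IsTranslationInvariant hF.action where
  source_mul _ _ _ := H.s_mul _ _ _
  anchor_mul_arr h k d := congrArg hF.vertex (H.r_mul h k d)
  mul_mul_arr e h k c d c' d' := by
    refine Eq.trans (hF.edgeMul_eq (c := c') (F.lift_mem e (H.r h) (hF.vertex_eq_iff.1 (Eq.symm c)))
      ((F.s_lift _ _ _).trans (H.r_mul h k d).symm)) ?_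
    exact (H.mul_assoc _ h k (F.s_lift _ _ _) d).symm

theorem IsNondegenerate.setOf_action_anchor_eq (v : Γ.V) :
    {ω | hF.action.anchor (H.one ω) = v} = F.Ω v := by
  ext ω
  change hF.vertex (H.r (H.one ω)) = v ↔ _
  rw [H.r_one, hF.vertex_eq_iff]

theorem IsNondegenerate.familyOfAction_action
    (hc : ∀ v : Γ.V, IsCompact {ω | hF.action.anchor (H.one ω) = v}) :
    familyOfAction hF.isTranslationInvariant hc = F := by
  ext1
  · exact funext hF.setOf_action_anchor_eq
  · funext e
    ext t
    constructor
    · rintro ⟨ω, c, rfl⟩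
      change H.mul _ _ _ ∈ _
      rw [H.mul_one_of_eq]
      exact F.lift_mem _ _ _
    · intro ht
      have c : Γ.s e = hF.vertex (H.r (H.one (H.s t))) := by
        rw [H.r_one]
        exact (hF.vertex_eq_iff.2 (F.s_mem ht)).symm
      exact ⟨H.s t, c, (hF.edgeMul_eq (c := c) ht (H.r_one _).symm).trans (H.mul_one t)⟩

end DynamicalCKFamily

variable {b : Γ.relativeCorrespondence.Action H.Arr} (hb : IsTranslationInvariant b)
  (hc : ∀ v : Γ.V, IsCompact {ω | b.anchor (H.one ω) = v})

theorem isNondegenerate_familyOfAction : (familyOfAction hb hc).IsNondegenerate :=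
  Set.eq_univ_of_forall fun ω => Set.mem_iUnion.2 ⟨b.anchor (H.one ω), rfl⟩

theorem action_familyOfAction (hF : (familyOfAction hb hc).IsNondegenerate) : hF.action = b := by
  refine action_ext (fun h => ?_) fun e h c c' => ?_
  · exact hF.vertex_eq_iff.2 (hb.anchor_eq h).symm
  · have c₁ : Γ.s e = b.anchor (H.one (H.r h)) := c'.trans (hb.anchor_eq h)
    have d : H.s (b.mul e (H.one (H.r h)) c₁) = H.r h := hb.source_mul_one _ _ _
    rw [hb.mul_eq e h c' c₁ d]
    exact hF.edgeMul_eq (c := c) ⟨_, c₁, rfl⟩ d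

end ActionOfFamily

end DirectedGraph

/-! ### Fibrewise ultrafilter compactification of a graph action. -/

namespace DirectedGraph

variable {Γ : DirectedGraph.{u}}

section Ultrafilter

variable {Y : Type u} [TopologicalSpace Y] (b : Γ.relativeCorrespondence.Action Y)

/-- A type synonym carrying the discrete topology. -/
def Discrete (Y : Type u) : Type u := Y

instance : TopologicalSpace (Discrete Y) := ⊥

instance : DiscreteTopology (Discrete Y) := ⟨rfl⟩

/-- The same action on the space with the discrete topology. -/
def discreteAction : Γ.relativeCorrespondence.Action (Discrete Y) :=
  actionOfEdges (Y := Discrete Y) b.anchor b.mul (fun _ => isOpen_discrete _)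
    (fun _ => continuous_of_discreteTopology) (fun _ _ _ => isOpen_discrete _)
    b.anchor_mul (fun _ _ _ _ _ _ => mul_injective b) b.exists_mul_eq
    (fun _ => isClosed_discrete _)

open Classical in
/-- Multiplication by an edge, extended to a total map. -/
noncomputable def edgeMap (e : Γ.E) (y : Y) : Y :=
  if c : Γ.s e = b.anchor y then b.mul e y c else y

theorem edgeMap_eq {e : Γ.E} {y : Y} (c : Γ.s e = b.anchor y) :
    edgeMap b e y = b.mul e y c := dif_pos c

/-- The ultrafilters on `Y` that contain a fibre of the anchor map. -/
def FibreUltrafilter : Type u := {U : Ultrafilter Y // ∃ v : Γ.V, b.anchor ⁻¹' {v} ∈ U}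

instance : TopologicalSpace (FibreUltrafilter b) :=
  inferInstanceAs (TopologicalSpace {U : Ultrafilter Y // ∃ v : Γ.V, b.anchor ⁻¹' {v} ∈ U})

/-- The vertex whose fibre belongs to an ultrafilter. -/
noncomputable def FibreUltrafilter.anchor (U : FibreUltrafilter b) : Γ.V := U.2.choose

variable {b}

theorem FibreUltrafilter.anchor_eq_iff {U : FibreUltrafilter b} {v : Γ.V} :
    FibreUltrafilter.anchor b U = v ↔ b.anchor ⁻¹' {v} ∈ U.1 := by
  constructor
  · rintro rfl
    exact U.2.choose_spec
  · intro h
    obtain ⟨y, hy, hy'⟩ := U.1.nonempty_of_mem (Filter.inter_mem U.2.choose_spec h)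
    exact hy.symm.trans hy'

theorem FibreUltrafilter.isOpen_setOf_mem (s : Set Y) :
    IsOpen {U : FibreUltrafilter b | s ∈ U.1} :=
  (ultrafilter_isOpen_basic s).preimage continuous_subtype_val

theorem FibreUltrafilter.isClosed_setOf_mem (s : Set Y) :
    IsClosed {U : FibreUltrafilter b | s ∈ U.1} :=
  (ultrafilter_isClosed_basic s).preimage continuous_subtype_val

theorem FibreUltrafilter.isOpen_iff {s : Set (FibreUltrafilter b)} :
    IsOpen s ↔ ∀ U ∈ s, ∃ t ∈ U.1, ∀ W : FibreUltrafilter b, t ∈ W.1 → W ∈ s := by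
  constructor
  · intro h U hU
    obtain ⟨t, ht, rfl⟩ := isOpen_induced_iff.1 h
    obtain ⟨_, ⟨t', rfl⟩, hU', ht'⟩ := ultrafilterBasis_is_basis.isOpen_iff.1 ht U.1 hU
    exact ⟨t', hU', fun W hW => ht' hW⟩
  · intro h
    refine isOpen_iff_forall_mem_open.2 fun U hU => ?_
    obtain ⟨t, ht, hts⟩ := h U hU
    exact ⟨_, hts, isOpen_setOf_mem t, ht⟩

/-- The fibre is a basic closed subset of the compact space of all ultrafilters on `Y`. -/
theorem FibreUltrafilter.isCompact_anchor_preimage (v : Γ.V) :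
    IsCompact (FibreUltrafilter.anchor b ⁻¹' {v}) := by
  refine Subtype.isCompact_iff.2 ?_
  convert (ultrafilter_isClosed_basic (b.anchor ⁻¹' {v})).isCompact using 1
  ext U
  constructor
  · rintro ⟨U, hU, rfl⟩
    exact anchor_eq_iff.1 hU
  · intro hU
    exact ⟨⟨U, v, hU⟩, anchor_eq_iff.2 hU, rfl⟩

/-- Multiplication of an ultrafilter by an edge. -/
noncomputable def FibreUltrafilter.mul (e : Γ.E) (U : FibreUltrafilter b)
    (c : Γ.s e = FibreUltrafilter.anchor b U) : FibreUltrafilter b :=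
  ⟨U.1.map (edgeMap b e), Γ.r e, by
    rw [Ultrafilter.mem_map]
    filter_upwards [anchor_eq_iff.1 c.symm] with y hy
    have hy' : Γ.s e = b.anchor y := Eq.symm hy
    rw [Set.mem_preimage, edgeMap_eq b hy']
    exact b.anchor_mul e y hy'⟩

theorem FibreUltrafilter.mem_mul_iff {e : Γ.E} {U : FibreUltrafilter b}
    {c : Γ.s e = FibreUltrafilter.anchor b U} {t : Set Y} :
    t ∈ (FibreUltrafilter.mul e U c).1 ↔ edgeMap b e ⁻¹' t ∈ U.1 := Iff.rfl

theorem FibreUltrafilter.image_mem_mul {e : Γ.E} {U : FibreUltrafilter b}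
    {c : Γ.s e = FibreUltrafilter.anchor b U} {t : Set Y} (ht : t ∈ U.1) :
    {z | ∃ y ∈ t, ∃ c : Γ.s e = b.anchor y, b.mul e y c = z} ∈ (FibreUltrafilter.mul e U c).1 := by
  rw [mem_mul_iff]
  filter_upwards [anchor_eq_iff.1 c.symm, ht] with y hy hyt
  exact ⟨y, hyt, Eq.symm hy, (edgeMap_eq b _).symm⟩

/-- An ultrafilter that contains all products `e · y` with `y ∈ t` is itself such a product. -/
theorem FibreUltrafilter.exists_mul_eq_of_mem {e : Γ.E} {W : FibreUltrafilter b} {t : Set Y}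
    (hW : {z | ∃ y ∈ t, ∃ c : Γ.s e = b.anchor y, b.mul e y c = z} ∈ W.1) :
    ∃ U c, FibreUltrafilter.mul e U c = W ∧ t ∈ U.1 := by
  have hinj : Function.Injective fun y : {y // y ∈ t ∧ Γ.s e = b.anchor y} =>
      b.mul e y.1 y.2.2 := fun y y' h => Subtype.ext (mul_injective b h).2
  have hrange :
      Set.range (fun y : {y // y ∈ t ∧ Γ.s e = b.anchor y} => b.mul e y.1 y.2.2) ∈ W.1 := by
    filter_upwards [hW]
    rintro _ ⟨y, hy, c, rfl⟩
    exact ⟨⟨y, hy, c⟩, rfl⟩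
  -- Since `y ↦ e · y` is injective and its image belongs to `W`, pulling `W` back along it again
  -- gives an ultrafilter.
  let U₀ := W.1.comap hinj hrange
  let U₁ : Ultrafilter Y := U₀.map Subtype.val
  have ht : ∀ᶠ y in U₁, y ∈ t ∧ Γ.s e = b.anchor y :=
    Filter.eventually_map.2 (Filter.Eventually.of_forall fun y => y.2)
  have hU : b.anchor ⁻¹' {Γ.s e} ∈ U₁ := by
    filter_upwards [ht] with y hy
    exact hy.2.symm
  let U : FibreUltrafilter b := ⟨U₁, Γ.s e, hU⟩
  refine ⟨U, (anchor_eq_iff.2 hU).symm, Subtype.ext ?_, ht.mono fun _ h => h.1⟩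
  change (U₀.map Subtype.val).map (edgeMap b e) = W.1
  rw [Ultrafilter.map_map]
  refine Ultrafilter.coe_injective ?_
  rw [Ultrafilter.coe_map, Ultrafilter.coe_comap]
  have : edgeMap b e ∘ Subtype.val =
      fun y : {y // y ∈ t ∧ Γ.s e = b.anchor y} => b.mul e y.1 y.2.2 :=
    funext fun y => edgeMap_eq b y.2.2
  rw [this, Filter.map_comap_of_mem hrange]

/-- For `t ∈ U` and `t' ∈ U'`, the sets `e · t` and `e' · t'` lie in a common ultrafilter, so they
meet. Then `e = e'` and `t` meets `t'`, which is impossible for complementary sets. -/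
theorem FibreUltrafilter.mul_injective {e e' : Γ.E} {U U' : FibreUltrafilter b}
    {c : Γ.s e = FibreUltrafilter.anchor b U} {c' : Γ.s e' = FibreUltrafilter.anchor b U'}
    (h : FibreUltrafilter.mul e U c = FibreUltrafilter.mul e' U' c') : e = e' ∧ U = U' := by
  have key : ∀ t ∈ U.1, ∀ t' ∈ U'.1, e = e' ∧ (t ∩ t').Nonempty := by
    intro t ht t' ht'
    have h₁ := image_mem_mul (c := c) ht
    rw [h] at h₁
    obtain ⟨_, ⟨y, hy, d, rfl⟩, ⟨y', hy', d', h₂⟩⟩ :=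
      Ultrafilter.nonempty_of_mem (Filter.inter_mem h₁ (image_mem_mul (c := c') ht'))
    obtain ⟨rfl, rfl⟩ := DirectedGraph.mul_injective b h₂
    exact ⟨rfl, y', hy, hy'⟩
  refine ⟨(key _ Filter.univ_mem _ Filter.univ_mem).1, Subtype.ext ?_⟩
  by_contra hne
  obtain ⟨t, ht, ht'⟩ : ∃ t ∈ U.1, t ∉ U'.1 := by
    by_contra! hall
    exact hne (Ultrafilter.eq_of_le hall).symm
  obtain ⟨y, hy, hy'⟩ := (key t ht tᶜ (Ultrafilter.compl_mem_iff_notMem.2 ht')).2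
  exact hy' hy

variable (b)

/-- The fibrewise Stone–Čech compactification of a discrete `Γ`-action. -/
noncomputable def ultrafilterAction : Γ.relativeCorrespondence.Action (FibreUltrafilter b) :=
  actionOfEdges (FibreUltrafilter.anchor b) FibreUltrafilter.mul
    (fun v => by
      convert FibreUltrafilter.isOpen_setOf_mem (b := b) (b.anchor ⁻¹' {v}) using 1
      ext U
      exact FibreUltrafilter.anchor_eq_iff)
    (fun e => by
      refine ⟨fun s hs => isOpen_induced_iff.2 ⟨⋃ (t : Set Y)
        (_ : ∀ W : FibreUltrafilter b, t ∈ W.1 → W ∈ s), {U | edgeMap b e ⁻¹' t ∈ U.1}, ?_, ?_⟩⟩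
      · exact isOpen_iUnion fun t => isOpen_iUnion fun _ => FibreUltrafilter.isOpen_setOf_mem _
      · ext U
        simp only [Set.mem_preimage, Set.mem_iUnion]
        constructor
        · rintro ⟨t, ht, hU⟩
          exact ht _ hU
        · intro hU
          obtain ⟨t, ht, hts⟩ := FibreUltrafilter.isOpen_iff.1 hs _ hU
          exact ⟨t, hts, ht⟩)
    (fun e s hs => by
      obtain ⟨s', hs', rfl⟩ := isOpen_induced_iff.1 hs
      rw [FibreUltrafilter.isOpen_iff]
      rintro _ ⟨⟨U, c⟩, hU, rfl⟩
      obtain ⟨t, ht, hts⟩ := FibreUltrafilter.isOpen_iff.1 hs' U hU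
      refine ⟨_, FibreUltrafilter.image_mem_mul ht, fun W hW => ?_⟩
      obtain ⟨U', c', rfl, h⟩ := FibreUltrafilter.exists_mul_eq_of_mem hW
      exact ⟨⟨U', c'⟩, hts U' h, rfl⟩)
    (fun e U c => FibreUltrafilter.anchor_eq_iff.2 (by
      rw [FibreUltrafilter.mem_mul_iff]
      filter_upwards [FibreUltrafilter.anchor_eq_iff.1 c.symm] with y hy
      have hy' : Γ.s e = b.anchor y := Eq.symm hy
      rw [Set.mem_preimage, edgeMap_eq b hy']
      exact b.anchor_mul e y hy'))
    (fun _ _ _ _ _ _ => FibreUltrafilter.mul_injective)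
    (fun W hW => by
      -- Regularity enters here: the fibre is covered by the sets `e · Y` for finitely many edges
      -- `e`, so `W` contains one of them.
      have h : ⋃ e ∈ Γ.r ⁻¹' {FibreUltrafilter.anchor b W},
          {z | ∃ y ∈ Set.univ, ∃ c : Γ.s e = b.anchor y, b.mul e y c = z} ∈ W.1 := by
        filter_upwards [FibreUltrafilter.anchor_eq_iff.1 rfl] with z hz
        have hz' : b.anchor z = FibreUltrafilter.anchor b W := hz
        obtain ⟨e, y, c, rfl⟩ := b.exists_mul_eq z (hz' ▸ hW)
        exact Set.mem_biUnion (x := e) ((b.anchor_mul e y c).symm.trans hz')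
          ⟨y, trivial, c, rfl⟩
      obtain ⟨e, -, he⟩ := (Ultrafilter.finite_biUnion_mem_iff hW.1).1 h
      obtain ⟨U, c, h, -⟩ := FibreUltrafilter.exists_mul_eq_of_mem he
      exact ⟨e, U, c, h⟩)
    (fun e => by
      convert FibreUltrafilter.isClosed_setOf_mem (b := b)
        {z | ∃ y ∈ Set.univ, ∃ c : Γ.s e = b.anchor y, b.mul e y c = z} using 1
      ext W
      constructor
      · rintro ⟨U, c, rfl⟩
        exact FibreUltrafilter.image_mem_mul (c := c) Filter.univ_mem
      · intro hW
        obtain ⟨U, c, h, -⟩ := FibreUltrafilter.exists_mul_eq_of_mem hW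
        exact ⟨U, c, h⟩)

/-- The inclusion of points as principal ultrafilters. -/
def principalUltrafilter (y : Discrete Y) : FibreUltrafilter b :=
  ⟨(pure y : Ultrafilter Y), b.anchor y, rfl⟩

theorem principalUltrafilter_equivariant :
    (discreteAction b).Equivariant (ultrafilterAction b) (principalUltrafilter b) := by
  refine equivariant_of_edges (fun y => FibreUltrafilter.anchor_eq_iff.2 rfl) ?_ ?_
  · intro e y c c'
    refine Subtype.ext ?_
    change (pure (b.mul e y c) : Ultrafilter Y) = (pure y : Ultrafilter Y).map (edgeMap b e)
    exact ((Ultrafilter.map_pure (edgeMap b e) (y : Y)).trans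
      (congrArg pure (edgeMap_eq b c))).symm
  · intro y e U c h
    have h₁ := FibreUltrafilter.image_mem_mul (c := c) (Filter.univ_mem (f := U.1.1))
    rw [show FibreUltrafilter.mul e U c = principalUltrafilter b y from h] at h₁
    obtain ⟨z, -, c', h₂⟩ := h₁
    exact ⟨e, z, c', h₂⟩

theorem discreteAction_equivariant_id :
    (discreteAction b).Equivariant b (fun y : Discrete Y => (y : Y)) :=
  equivariant_of_edges (fun _ => rfl) (fun _ _ _ _ => rfl)
    fun _ e z c h => ⟨e, z, c, h⟩

theorem equivariant_comp {Y₁ Y₂ Y₃ : Type u} [TopologicalSpace Y₁] [TopologicalSpace Y₂]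
    [TopologicalSpace Y₃] {b₁ : Γ.relativeCorrespondence.Action Y₁}
    {b₂ : Γ.relativeCorrespondence.Action Y₂} {b₃ : Γ.relativeCorrespondence.Action Y₃}
    {φ : Y₁ → Y₂} {ψ : Y₂ → Y₃} (hψ : b₂.Equivariant b₃ ψ) (hφ : b₁.Equivariant b₂ φ) :
    b₁.Equivariant b₃ (ψ ∘ φ) := by
  refine equivariant_of_edges (fun y => (hψ.1.1 _).trans (hφ.1.1 y)) ?_ ?_
  · intro e y c c'
    rw [Function.comp, hφ.2.1 e y c (c.trans (hφ.1.1 y).symm)]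
    exact hψ.2.1 _ _ _ _
  · intro y e z c h
    rw [← hφ.2.2, ← hψ.2.2]
    exact ⟨e, z, c, h⟩

end Ultrafilter

/-! ### Compact fibres of the model's object space, and properness. -/

section Model

variable {M H : EtaleGroupoid.{u}} (𝓜 : GroupoidModel Γ.relativeCorrespondence M)

/-- The `Γ`-action on the object space of a groupoid model. -/
def objAction : Γ.relativeCorrespondence.Action M.Obj := 𝓜.actionEquiv M.Obj M.objAction

theorem equivariant_objAction_iff {Y : Type u} [TopologicalSpace Y] (a : LeftAction M Y)
    {φ : Y → M.Obj} (hφ : Continuous φ) :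
    (𝓜.actionEquiv Y a).Equivariant (objAction 𝓜) φ ↔ φ = a.anchor :=
  (𝓜.equivariant_iff a _ φ hφ).trans (a.equivariant_objAction_iff φ)

/-- The anchor of the ultrafilter action is an equivariant retraction onto `M.Obj`, so it maps each
compact fibre of ultrafilters onto the fibre of `M.Obj` over the same vertex. -/
theorem isCompact_objAction_anchor_preimage (v : Γ.V) :
    IsCompact ((objAction 𝓜).anchor ⁻¹' {v}) := by
  let b := objAction 𝓜
  let a := (𝓜.actionEquiv _).symm (ultrafilterAction b)
  have ha : 𝓜.actionEquiv _ a = ultrafilterAction b := Equiv.apply_symm_apply _ _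
  have heq : (ultrafilterAction b).Equivariant b a.anchor :=
    ha ▸ (equivariant_objAction_iff 𝓜 a a.continuous_anchor).2 rfl
  let d := (𝓜.actionEquiv _).symm (discreteAction b)
  have hd : 𝓜.actionEquiv _ d = discreteAction b := Equiv.apply_symm_apply _ _
  -- Both sides are equivariant maps to the terminal action. The model compares only continuous
  -- maps, and the inclusion of principal ultrafilters need not be continuous on `M.Obj`; hence the
  -- discrete topology on the domain.
  have hcomp : ∀ x : M.Obj, a.anchor (principalUltrafilter b x) = x := by
    have h₁ := equivariant_comp heq (principalUltrafilter_equivariant b)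
    have h₂ := discreteAction_equivariant_id b
    rw [← hd] at h₁ h₂
    have h₁' := (equivariant_objAction_iff 𝓜 d continuous_of_discreteTopology).1 h₁
    have h₂' := (equivariant_objAction_iff 𝓜 d continuous_of_discreteTopology).1 h₂
    exact congrFun (h₁'.trans h₂'.symm)
  have himage : b.anchor ⁻¹' {v} = a.anchor '' (FibreUltrafilter.anchor b ⁻¹' {v}) := by
    ext x
    constructor
    · intro hx
      exact ⟨principalUltrafilter b x,
        ((principalUltrafilter_equivariant b).1.1 x).trans hx, hcomp x⟩
    · rintro ⟨U, hU, rfl⟩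
      exact (heq.1.1 U).trans hU
  exact himage ▸ (FibreUltrafilter.isCompact_anchor_preimage v).image a.continuous_anchor

/-- The anchor of the actor is graph-equivariant, so `H⁰ → V` factors through `M⁰ → V`. Compact
fibres of `M⁰ → V` give one direction; the other cancels the second factor, as `M⁰` is Hausdorff. -/
theorem isProper_iff (A : Actor M H) :
    A.IsProper ↔ ∀ v : Γ.V,
      IsCompact {ω | (𝓜.actionEquiv H.Arr A.toLeftAction).anchor (H.one ω) = v} := by
  have h : ∀ ω, (objAction 𝓜).anchor (A.anchor (H.one ω)) =
      (𝓜.actionEquiv H.Arr A.toLeftAction).anchor (H.one ω) := fun ω =>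
    ((equivariant_objAction_iff 𝓜 A.toLeftAction A.continuous_anchor).2 rfl).1.1 _
  simp only [← h]
  constructor
  · intro hA v
    exact hA.isCompact_preimage (isCompact_objAction_anchor_preimage 𝓜 v)
  · intro hA
    have hf : Continuous fun ω => A.anchor (H.one ω) :=
      A.continuous_anchor.comp H.continuous_one
    have hg : Continuous (objAction 𝓜).anchor := (objAction 𝓜).continuous_anchor
    refine isProperMap_of_comp_of_t2 hf hg ?_
    rw [isProperMap_iff_isCompact_preimage]
    refine ⟨hg.comp hf, fun K hK => ?_⟩
    rw [← Set.biUnion_preimage_singleton]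
    -- Compact subsets of the discrete set `V` are finite, so compactness of single fibres suffices.
    exact hK.finite_of_discrete.isCompact_biUnion fun v _ => hA v

end Model

end DirectedGraph

/-! ### Assembling the bijection. -/

theorem Actor.toLeftAction_injective {M H : EtaleGroupoid.{u}} :
    Function.Injective (Actor.toLeftAction : Actor M H → LeftAction M H.Arr) := by
  rintro ⟨a, _⟩ ⟨_, _⟩ rfl
  rfl

namespace DirectedGraph

variable {Γ : DirectedGraph.{u}} {M H : EtaleGroupoid.{u}}
  (𝓜 : GroupoidModel Γ.relativeCorrespondence M)

/-- The actor given by a nondegenerate dynamical Cuntz–Krieger family. -/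
noncomputable def DynamicalCKFamily.IsNondegenerate.actor {F : Γ.DynamicalCKFamily H}
    (hF : F.IsNondegenerate) : Actor M H where
  toLeftAction := (𝓜.actionEquiv H.Arr).symm hF.action
  commute := actionsCommute_of_isTranslationInvariant 𝓜 _ (by
    rw [Equiv.apply_symm_apply]
    exact hF.isTranslationInvariant)

theorem DynamicalCKFamily.IsNondegenerate.actionEquiv_actor {F : Γ.DynamicalCKFamily H}
    (hF : F.IsNondegenerate) :
    𝓜.actionEquiv H.Arr (hF.actor 𝓜).toLeftAction = hF.action :=
  Equiv.apply_symm_apply _ _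

theorem DynamicalCKFamily.IsNondegenerate.isProper_actor {F : Γ.DynamicalCKFamily H}
    (hF : F.IsNondegenerate) : (hF.actor 𝓜).IsProper := by
  rw [isProper_iff 𝓜, hF.actionEquiv_actor]
  intro v
  rw [hF.setOf_action_anchor_eq]
  exact F.isCompact_Ω v

theorem familyOfAction_congr {b b' : Γ.relativeCorrespondence.Action H.Arr} (h : b = b')
    (hb : IsTranslationInvariant b) (hc : ∀ v : Γ.V, IsCompact {ω | b.anchor (H.one ω) = v})
    (hb' : IsTranslationInvariant b')
    (hc' : ∀ v : Γ.V, IsCompact {ω | b'.anchor (H.one ω) = v}) :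
    familyOfAction hb hc = familyOfAction hb' hc' := by
  subst h
  rfl

/-- The family associated to a proper actor. -/
def familyOfActor (A : Actor M H) (hA : A.IsProper) : Γ.DynamicalCKFamily H :=
  familyOfAction (isTranslationInvariant_of_actor 𝓜 A) ((isProper_iff 𝓜 A).1 hA)

theorem familyOfActor_actor {F : Γ.DynamicalCKFamily H} (hF : F.IsNondegenerate) :
    familyOfActor 𝓜 (hF.actor 𝓜) (hF.isProper_actor 𝓜) = F := by
  have hc : ∀ v : Γ.V, IsCompact {ω | hF.action.anchor (H.one ω) = v} := by
    intro v
    rw [hF.setOf_action_anchor_eq]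
    exact F.isCompact_Ω v
  exact (familyOfAction_congr (hF.actionEquiv_actor 𝓜) _ _ hF.isTranslationInvariant hc).trans
    (hF.familyOfAction_action hc)

/-- Proper actors correspond to nondegenerate dynamical Cuntz–Krieger families. -/
noncomputable def properActorEquiv :
    {A : Actor M H // A.IsProper} ≃ {F : Γ.DynamicalCKFamily H // F.IsNondegenerate} where
  toFun A := ⟨familyOfActor 𝓜 A.1 A.2, isNondegenerate_familyOfAction _ _⟩
  invFun F := ⟨F.2.actor 𝓜, F.2.isProper_actor 𝓜⟩
  left_inv A := by
    refine Subtype.ext (Actor.toLeftAction_injective ((𝓜.actionEquiv H.Arr).injective ?_))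
    exact (DynamicalCKFamily.IsNondegenerate.actionEquiv_actor 𝓜 _).trans
      (action_familyOfAction (isTranslationInvariant_of_actor 𝓜 A.1) _ _)
  right_inv F := Subtype.ext (familyOfActor_actor 𝓜 F.2)

end DirectedGraph

theorem mainTheorem1 (Γ : DirectedGraph.{u}) (M H : EtaleGroupoid.{u})
    (𝓜 : GroupoidModel Γ.relativeCorrespondence M) :
    ∃ Φ : {A : Actor M H // A.IsProper} ≃ {F : Γ.DynamicalCKFamily H // F.IsNondegenerate},
      ∀ A : {A : Actor M H // A.IsProper},
        let b := 𝓜.actionEquiv H.Arr A.1.toLeftAction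
        (∀ v : Γ.V, (Φ A).1.Ω v = {ω : H.Obj | b.anchor (H.one ω) = v}) ∧
        (∀ e : Γ.E, (Φ A).1.T e =
          {h : H.Arr | ∃ (ω : H.Obj) (c : Γ.s e = b.anchor (H.one ω)),
            b.mul e (H.one ω) c = h}) :=
  ⟨DirectedGraph.properActorEquiv 𝓜, fun _ => ⟨fun _ => rfl, fun _ => rfl⟩⟩
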